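/- Let $\Sigma$ be a finite set with at least two elements, let $P=(p_{ik})_{i,k\in\Sigma}$ be the transition matrix of an irreducible, aperiodic Markov chain on $\Sigma$, and fix an initial state $i_0\in\Sigma$. For $\theta\in\mathbb R$ let $A(\theta)=(p_{ik}^{\theta})_{i,k\in\Sigma}$, with the convention $p_{ik}^{\theta}=0$ whenever $p_{ik}=0$, and let $\rho(\theta)\in\mathbb R$ be the maximum modulus eigenvalue of $A(\theta)$, i.e. the simple root of its characteristic polynomial whose modulus is strictly larger than that of every other complex root; it exists for every $\theta$, and $\rho$ is differentiable on $\mathbb R$. Put $$C_*:=\lim_{\theta\to-\infty}\frac{\rho(\theta)}{-\rho'(\theta)},$$ where the limit exists and $0<C_*<\infty$. Each word $u=(i_1,\dots,i_n)\in\Sigma^n$, $n\ge 0$, indexes a box of generation $n$, of size $p_{i_0i_1}p_{i_1i_2}\cdots p_{i_{n-1}i_n}$ (the box of the empty word has size $1$); only the boxes of positive size, i.e. those that correspond to possible trajectories, are considered. Balls are thrown one after the other, and their trajectories $Y^{(1)},Y^{(2)},\dots$ are independent Markov chains with transition matrix $P$ started from $i_0$; the $b$-th ball lies in the box of generation $n$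 indexed by $(Y^{(b)}_1,\dots,Y^{(b)}_n)$. For $m\ge 0$ and $j\ge1$ let the saturation level $G_{m,j}$ be the first generation at which some box contains strictly fewer than $j$ of the first $m$ balls; such a generation always exists. Then, for every $j\ge 1$, $$\lim_{m\to\infty}\frac{G_{m,j}}{\ln m}=C_*\qquad\text{almost surely.}$$ -/

import Mathlib

open MeasureTheory ProbabilityTheory Filter Topology

noncomputable section

namespace MarkovTrie

variable {S : Type*}

/-- Aperiodicity: for each state `i`, the greatest common divisor of the possible return times
`{n ≥ 1 : (P ^ n) i i > 0}` is `1`. -/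
def IsAperiodic [Fintype S] [DecidableEq S] (P : Matrix S S ℝ) : Prop :=
  ∀ (i : S) (d : ℕ), (∀ n : ℕ, 1 ≤ n → 0 < (P ^ n) i i → d ∣ n) → d = 1

/-- The matrix `A(θ)` with entries `p_{ik} ^ θ`, where vanishing entries stay `0` for every real
`θ` (also for `θ ≤ 0`). -/
def powMatrix (P : Matrix S S ℝ) (θ : ℝ) : Matrix S S ℝ :=
  open Classical in Matrix.of fun i k => if P i k = 0 then 0 else P i k ^ θ

/-- `r` is a maximum modulus eigenvalue of `A`: a simple root of the characteristic polynomial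
whose modulus is strictly larger than that of every other complex root. -/
def IsMaxModulusEigenvalue [Fintype S] [DecidableEq S] (A : Matrix S S ℝ) (r : ℂ) : Prop :=
  (A.map (algebraMap ℝ ℂ)).charpoly.rootMultiplicity r = 1 ∧
    ∀ z : ℂ, (A.map (algebraMap ℝ ℂ)).charpoly.IsRoot z → z ≠ r → ‖z‖ < ‖r‖

/-- `X` is a Markov chain on `S` with transition matrix `P` and initial state `i₀`. -/
structure IsMarkovChain [DecidableEq S] [MeasurableSpace S] {Ω : Type*} [MeasurableSpace Ω]
    (X : ℕ → Ω → S) (P : Matrix S S ℝ) (i₀ : S) (μ : Measure Ω) : Prop where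
  measurable : ∀ n, Measurable (X n)
  law : ∀ (w : ℕ → S) (n : ℕ), μ {ω | ∀ k ≤ n, X k ω = w k} =
    if w 0 = i₀ then ENNReal.ofReal (∏ k ∈ Finset.range n, P (w k) (w (k + 1))) else 0

/-- The size `p_{i₀ u₁} p_{u₁ u₂} ⋯ p_{uₙ₋₁ uₙ}` of the box of generation `n` indexed by the word
`u = (u₁, …, uₙ)`, when the root box has type `i₀` and size `1`. -/
def boxSize (P : Matrix S S ℝ) (i₀ : S) {n : ℕ} (u : Fin n → S) : ℝ :=
  ∏ k : Fin n, P ((Fin.cons i₀ u : Fin (n + 1) → S) k.castSucc) (u k)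

variable {Ω : Type*}

/-- The number of balls among the first `m` (those numbered `0, …, m - 1`) that lie in the box
indexed by `u`. Here `Y b` is the trajectory of ball `b`, so that the ball is in the box of
generation `n` indexed by `u` iff `(Y b 1, …, Y b n) = u`. -/
def ballCount (Y : ℕ → ℕ → Ω → S) (m : ℕ) {n : ℕ} (u : Fin n → S) (ω : Ω) : ℕ :=
  open Classical in ((Finset.range m).filter fun b => ∀ k : Fin n, Y b (k + 1) ω = u k).card

/-- When `m` balls have been thrown, some box of generation `n` (of positive size, i.e. one that
represents a possible trajectory) holds strictly fewer than `j` balls. -/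
def HasDeficientBox (P : Matrix S S ℝ) (i₀ : S) (Y : ℕ → ℕ → Ω → S) (m j n : ℕ) (ω : Ω) : Prop :=
  ∃ u : Fin n → S, 0 < boxSize P i₀ u ∧ ballCount Y m u ω < j

/-- The saturation level `G_{m,j}`: the first generation with a box that holds strictly fewer
than `j` balls when `m` balls have been thrown. -/
def saturationLevel (P : Matrix S S ℝ) (i₀ : S) (Y : ℕ → ℕ → Ω → S) (m j : ℕ) (ω : Ω) : ℕ :=
  sInf {n : ℕ | HasDeficientBox P i₀ Y m j n ω}

end MarkovTrie

end

/-!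
The Perron root `ρ θ` of `A(θ)` governs the partition function `∑ u, boxSize u ^ θ` of generation
`n`, which is `ρ θ ^ n` up to constants. The function `log ρ` is convex (Hölder) with negative
derivative bounded below, so `(log ρ)'` has a limit `-l < 0` at `-∞`, and `ρ / (-ρ')` tends to
`1 / l`. As negative powers single out the smallest summand, the smallest positive box of generation
`n` has size `exp (-n (l + o(1)))`. With `m = exp (n κ)` balls and `κ < l`, a smallest box is
expected to hold `m exp (-n (l + o(1))) → 0` balls, so it is empty for all large `n` by
Borel-Cantelli. If `κ > l`, every positive box is expected to hold exponentially many balls,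
independence makes the probability of fewer than `j` doubly exponentially small, and a union bound
over the at most `(card S) ^ n` boxes together with Borel-Cantelli excludes deficient boxes for all
large `n`.
-/

namespace MarkovTrie

open Matrix

section Primitive

variable {S : Type*} [Fintype S] [DecidableEq S] {A B P : Matrix S S ℝ} {i j k : S} {m n : ℕ}

lemma pow_add_apply_pos (hA : ∀ i j, 0 ≤ A i j) (hm : 0 < (A ^ m) i j) (hn : 0 < (A ^ n) j k) :
    0 < (A ^ (m + n)) i k := by
  rw [pow_add, mul_apply]
  exact Finset.sum_pos'
    (fun l _ => mul_nonneg (pow_apply_nonneg hA m i l) (pow_apply_nonneg hA n l k))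
    ⟨j, Finset.mem_univ j, mul_pos hm hn⟩

lemma exists_pow_apply_pos_of_pow_succ_apply_pos (hA : ∀ i j, 0 ≤ A i j)
    (h : 0 < (A ^ (n + 1)) i j) : ∃ l, 0 < (A ^ n) i l ∧ 0 < A l j := by
  rw [pow_succ, mul_apply] at h
  obtain ⟨l, -, hl⟩ := Finset.exists_lt_of_sum_lt (s := Finset.univ) (f := fun _ => (0 : ℝ))
    (by simpa using h)
  exact ⟨l, pos_of_mul_pos_left hl (hA l j),
    pos_of_mul_pos_right hl (pow_apply_nonneg hA n i l)⟩

lemma pow_apply_pos_of_imp (hA : ∀ i j, 0 ≤ A i j) (hB : ∀ i j, 0 ≤ B i j)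
    (h : ∀ i j, 0 < A i j → 0 < B i j) (n : ℕ) (hij : 0 < (A ^ n) i j) : 0 < (B ^ n) i j := by
  induction n generalizing j with
  | zero => simpa using hij
  | succ n ih =>
    obtain ⟨l, hil, hlj⟩ := exists_pow_apply_pos_of_pow_succ_apply_pos hA hij
    exact pow_add_apply_pos hB (ih hil) (by simpa using h l j hlj)

lemma isPrimitive_of_imp (hA : A.IsPrimitive) (hB : ∀ i j, 0 ≤ B i j)
    (h : ∀ i j, 0 < A i j → 0 < B i j) : B.IsPrimitive := by
  obtain ⟨k, hk, hpos⟩ := hA.exists_pos_pow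
  exact ⟨hB, k, hk, fun i j => pow_apply_pos_of_imp hA.nonneg hB h k (hpos i j)⟩

/-- The additive monoid of the times at which the chain with weights `A` can be back at `i`; it
turns aperiodicity into a statement about numerical semigroups. -/
def returnTimes (hA : ∀ i j, 0 ≤ A i j) (i : S) : AddSubmonoid ℕ where
  carrier := {n | 0 < (A ^ n) i i}
  zero_mem' := by simp
  add_mem' := pow_add_apply_pos hA

lemma IsAperiodic.eventually_pow_apply_self_pos (haper : IsAperiodic P) (hP : ∀ i j, 0 ≤ P i j)
    (i : S) : ∀ᶠ n in atTop, 0 < (P ^ n) i i := by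
  have hgcd : Nat.setGcd (returnTimes hP i) = 1 :=
    haper i _ fun n _ hn => Nat.setGcd_dvd_of_mem (s := returnTimes hP i) hn
  obtain ⟨N, hN⟩ := Nat.exists_mem_closure_of_ge (returnTimes hP i : Set ℕ)
  rw [AddSubmonoid.closure_eq, hgcd] at hN
  exact eventually_atTop.2 ⟨N, fun n hn => hN n hn (one_dvd n)⟩

lemma IsAperiodic.eventually_pow_apply_pos (haper : IsAperiodic P) (hirr : P.IsIrreducible)
    (i j : S) : ∀ᶠ n in atTop, 0 < (P ^ n) i j := by
  obtain ⟨k, -, hk⟩ := (isIrreducible_iff_exists_pow_pos hirr.nonneg).1 hirr i j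
  filter_upwards [(tendsto_sub_atTop_nat k).eventually
    (haper.eventually_pow_apply_self_pos hirr.nonneg i), eventually_ge_atTop k] with n hn hkn
  simpa only [Nat.sub_add_cancel hkn] using pow_add_apply_pos hirr.nonneg hn hk

lemma IsAperiodic.isPrimitive (haper : IsAperiodic P) (hirr : P.IsIrreducible) :
    P.IsPrimitive := by
  have hev : ∀ᶠ n in atTop, ∀ i j, 0 < (P ^ n) i j :=
    eventually_all.2 fun i => eventually_all.2 fun j => haper.eventually_pow_apply_pos hirr i j
  obtain ⟨k, hpos, hk⟩ := (hev.and (eventually_gt_atTop 0)).exists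
  exact ⟨hirr.nonneg, k, hk, hpos⟩

lemma one_le_pow_apply_of_pos (hA : ∀ i j, 0 ≤ A i j) (h : ∀ i j, 0 < A i j → 1 ≤ A i j) (n : ℕ)
    (hij : 0 < (A ^ n) i j) : 1 ≤ (A ^ n) i j := by
  induction n generalizing j with
  | zero =>
    obtain rfl : i = j := by
      by_contra hne
      simp [hne] at hij
    simp
  | succ n ih =>
    obtain ⟨l, hil, hlj⟩ := exists_pow_apply_pos_of_pow_succ_apply_pos hA hij
    rw [pow_succ, mul_apply]
    exact (one_le_mul_of_one_le_of_one_le (ih hil) (h l j hlj)).trans <|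
      Finset.single_le_sum (f := fun l => (A ^ n) i l * A l j)
        (fun l _ => mul_nonneg (pow_apply_nonneg hA n i l) (hA l j)) (Finset.mem_univ l)

lemma exists_pos_lt_one_of_isPrimitive [Nontrivial S] (hP : P ∈ rowStochastic ℝ S)
    (hprim : P.IsPrimitive) : ∃ i j, 0 < P i j ∧ P i j < 1 := by
  by_contra! h
  obtain ⟨k, -, hpos⟩ := hprim.exists_pos_pow
  obtain ⟨i, -⟩ := exists_pair_ne S
  have hrow : ∑ j, (P ^ k) i j = 1 := sum_row_of_mem_rowStochastic (pow_mem hP k) i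
  have hcard : (Fintype.card S : ℝ) ≤ ∑ j, (P ^ k) i j := by
    simpa using Finset.sum_le_sum fun j (_ : j ∈ Finset.univ) =>
      one_le_pow_apply_of_pos hprim.nonneg h k (hpos i j)
  rw [hrow] at hcard
  exact Fintype.one_lt_card.not_ge (by exact_mod_cast hcard)

end Primitive

section NonnegativeMatrices

variable {S : Type*} [Fintype S] {A B : Matrix S S ℝ} {v w x y z : S → ℝ} {t : ℝ}

lemma mulVec_pos (hB : ∀ i j, 0 < B i j) (hx : 0 < x) (i : S) : 0 < (B *ᵥ x) i := by
  obtain ⟨hx0, j, hj⟩ := Pi.lt_def.1 hx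
  exact Finset.sum_pos' (fun j _ => mul_nonneg (hB i j).le (hx0 j))
    ⟨j, Finset.mem_univ j, mul_pos (hB i j) hj⟩

lemma dotProduct_pos [Nonempty S] (hw : ∀ i, 0 < w i) (hv : ∀ i, 0 < v i) : 0 < w ⬝ᵥ v :=
  Finset.sum_pos (fun i _ => mul_pos (hw i) (hv i)) Finset.univ_nonempty

lemma pow_mulVec_of_mulVec_eq_smul {R : Type*} [CommSemiring R] [DecidableEq S]
    {A : Matrix S S R} {v : S → R} {r : R} (h : A *ᵥ v = r • v) (n : ℕ) :
    A ^ n *ᵥ v = r ^ n • v := by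
  induction n with
  | zero => simp
  | succ n ih => rw [pow_succ, ← mulVec_mulVec, h, mulVec_smul, ih, smul_smul, pow_succ']

lemma isPrimitive_transpose [DecidableEq S] (hA : A.IsPrimitive) : Aᵀ.IsPrimitive := by
  obtain ⟨k, hk, hpos⟩ := hA.exists_pos_pow
  exact ⟨fun i j => hA.nonneg j i, k, hk, fun i j => by rw [← transpose_pow]; exact hpos j i⟩

lemma pos_of_mem_stdSimplex (hx : x ∈ stdSimplex ℝ S) : 0 < x := by
  refine lt_of_le_of_ne (fun i => hx.1 i) ?_
  rintro rfl
  simpa using hx.2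

lemma inv_sum_smul_mem_stdSimplex [Nonempty S] (hy : ∀ i, 0 < y i) :
    (∑ i, y i)⁻¹ • y ∈ stdSimplex ℝ S := by
  have hs : 0 < ∑ i, y i := Finset.sum_pos (fun i _ => hy i) Finset.univ_nonempty
  refine ⟨fun i => mul_nonneg (inv_nonneg.2 hs.le) (hy i).le, ?_⟩
  simp only [Pi.smul_apply, smul_eq_mul, ← Finset.mul_sum]
  exact inv_mul_cancel₀ hs.ne'

lemma exists_gt_forall_mul_le {ι : Type*} [Finite ι] [Nonempty ι] {y z : ι → ℝ}
    (hy : ∀ i, 0 < y i) (h : ∀ i, t * y i < z i) : ∃ t' > t, ∀ i, t' * y i ≤ z i := by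
  obtain ⟨i₁, hi₁⟩ := Finite.exists_min fun i => z i / y i
  exact ⟨z i₁ / y i₁, (lt_div_iff₀ (hy i₁)).2 (h i₁), fun i => (le_div_iff₀ (hy i)).1 (hi₁ i)⟩

end NonnegativeMatrices

section CollatzWielandt

variable {S : Type*} [Fintype S] {A : Matrix S S ℝ} {t r : ℝ} {x : S → ℝ}

/-- The pairs `(t, x)` of a number `t ≥ 0` and a probability vector `x` with `t x ≤ A x`. The
largest possible `t` is the Perron eigenvalue (Collatz–Wielandt). -/
def collatzWielandtSet (A : Matrix S S ℝ) : Set (ℝ × (S → ℝ)) :=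
  {p | 0 ≤ p.1 ∧ p.2 ∈ stdSimplex ℝ S ∧ ∀ i, p.1 * p.2 i ≤ (A *ᵥ p.2) i}

lemma le_sum_of_mem_collatzWielandtSet (hA : ∀ i j, 0 ≤ A i j)
    (h : (t, x) ∈ collatzWielandtSet A) : t ≤ ∑ i, ∑ j, A i j := by
  obtain ⟨-, hx, hle⟩ := h
  calc t = ∑ i, t * x i := by rw [← Finset.mul_sum, hx.2, mul_one]
    _ ≤ ∑ i, (A *ᵥ x) i := Finset.sum_le_sum fun i _ => hle i
    _ ≤ ∑ i, ∑ j, A i j := Finset.sum_le_sum fun i _ => Finset.sum_le_sum fun j _ =>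
      mul_le_of_le_one_right (hA i j) (mem_Icc_of_mem_stdSimplex hx j).2

lemma isCompact_collatzWielandtSet (hA : ∀ i j, 0 ≤ A i j) :
    IsCompact (collatzWielandtSet A) := by
  refine (isCompact_Icc.prod (isCompact_stdSimplex ℝ S)).of_isClosed_subset ?_
    fun p hp => ⟨⟨hp.1, le_sum_of_mem_collatzWielandtSet hA hp⟩, hp.2.1⟩
  exact (isClosed_le continuous_const continuous_fst).inter
    (((isClosed_stdSimplex ℝ S).preimage continuous_snd).inter
      (isClosed_le (f := fun p : ℝ × (S → ℝ) => p.1 • p.2) (by fun_prop)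
        (continuous_const.matrix_mulVec continuous_snd)))

lemma collatzWielandtSet_nonempty [Nonempty S] (hA : ∀ i j, 0 ≤ A i j) :
    (collatzWielandtSet A).Nonempty := by
  obtain ⟨x, hx⟩ := (Set.Nonempty.of_subtype : (stdSimplex ℝ S).Nonempty)
  refine ⟨(0, x), le_rfl, hx, fun i => ?_⟩
  rw [zero_mul]
  exact Finset.sum_nonneg fun j _ => mul_nonneg (hA i j) (hx.1 j)

variable [DecidableEq S]

lemma mulVec_eq_smul_of_isMaxOn [Nonempty S] (hA : A.IsPrimitive)
    (hx : (r, x) ∈ collatzWielandtSet A)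
    (hmax : ∀ t y, (t, y) ∈ collatzWielandtSet A → t ≤ r) : A *ᵥ x = r • x := by
  obtain ⟨k, -, hk⟩ := hA.exists_pos_pow
  obtain ⟨hr, hxmem, hle⟩ := hx
  by_contra hne
  have hdefect : 0 < A *ᵥ x - r • x :=
    sub_pos.2 (lt_of_le_of_ne (fun i => hle i) (Ne.symm hne))
  have hy : ∀ i, 0 < (A ^ k *ᵥ x) i := mulVec_pos hk (pos_of_mem_stdSimplex hxmem)
  have hstrict : ∀ i, r * (A ^ k *ᵥ x) i < (A *ᵥ (A ^ k *ᵥ x)) i := fun i => by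
    have hi := mulVec_pos hk hdefect i
    rwa [mulVec_sub, mulVec_smul, mulVec_mulVec, ← pow_succ, pow_succ', ← mulVec_mulVec,
      Pi.sub_apply, sub_pos] at hi
  obtain ⟨t, hrt, ht⟩ := exists_gt_forall_mul_le hy hstrict
  refine hrt.not_ge (hmax t _ ⟨hr.trans hrt.le, inv_sum_smul_mem_stdSimplex hy, fun i => ?_⟩)
  simp only [mulVec_smul, Pi.smul_apply, smul_eq_mul, mul_left_comm t]
  exact mul_le_mul_of_nonneg_left (ht i)
    (inv_nonneg.2 (Finset.sum_nonneg fun i _ => (hy i).le))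

theorem exists_pos_eigenvector [Nonempty S] (hA : A.IsPrimitive) :
    ∃ (r : ℝ) (v : S → ℝ), 0 < r ∧ (∀ i, 0 < v i) ∧ ∑ i, v i = 1 ∧ A *ᵥ v = r • v := by
  obtain ⟨⟨r, x⟩, hmem, hmax⟩ := (isCompact_collatzWielandtSet hA.nonneg).exists_isMaxOn
    (collatzWielandtSet_nonempty hA.nonneg) continuous_fst.continuousOn
  have heq : A *ᵥ x = r • x := mulVec_eq_smul_of_isMaxOn hA hmem fun t y h => hmax h
  obtain ⟨hr, hx, -⟩ := hmem
  obtain ⟨k, hk, hpos⟩ := hA.exists_pos_pow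
  have hrx : ∀ i, 0 < r ^ k * x i := fun i => by
    have hi := mulVec_pos hpos (pos_of_mem_stdSimplex hx) i
    rwa [pow_mulVec_of_mulVec_eq_smul heq] at hi
  have hr0 : r ≠ 0 := by
    rintro rfl
    simpa [hk.ne'] using hrx (Classical.arbitrary S)
  exact ⟨r, x, hr.lt_of_ne' hr0, fun i => pos_of_mul_pos_right (hrx i) (pow_nonneg hr k),
    hx.2, heq⟩

end CollatzWielandt

section Perron

variable {S : Type*} [Fintype S] {A : Matrix S S ℝ} {r c : ℝ} {v w x : S → ℝ}

/-- `r > 0` is an eigenvalue of `A` with positive right and left eigenvectors `v` and `w`, of which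
`v` is normalised to a probability vector. These are the objects of the Perron–Frobenius theorem. -/
structure IsPerron (A : Matrix S S ℝ) (r : ℝ) (v w : S → ℝ) : Prop where
  pos : 0 < r
  right_pos : ∀ i, 0 < v i
  right_sum : ∑ i, v i = 1
  left_pos : ∀ i, 0 < w i
  right_eq : A *ᵥ v = r • v
  left_eq : w ᵥ* A = r • w

theorem exists_isPerron [DecidableEq S] [Nonempty S] (hA : A.IsPrimitive) :
    ∃ r v w, IsPerron A r v w := by
  obtain ⟨r, v, hr, hv, hsum, hAv⟩ := exists_pos_eigenvector hA
  obtain ⟨r', w, -, hw, -, hAw⟩ := exists_pos_eigenvector (isPrimitive_transpose hA)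
  rw [mulVec_transpose] at hAw
  have hrr : r' * (w ⬝ᵥ v) = r * (w ⬝ᵥ v) := by
    rw [← smul_eq_mul, ← smul_eq_mul, ← smul_dotProduct, ← hAw, ← dotProduct_mulVec, hAv,
      dotProduct_smul]
  obtain rfl := mul_right_cancel₀ (dotProduct_pos hw hv).ne' hrr
  exact ⟨r', v, w, hr, hv, hsum, hw, hAv, hAw⟩

namespace IsPerron

lemma dotProduct_pos [Nonempty S] (h : IsPerron A r v w) : 0 < w ⬝ᵥ v :=
  MarkovTrie.dotProduct_pos h.left_pos h.right_pos

lemma left_dotProduct_mulVec (h : IsPerron A r v w) (x : S → ℝ) :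
    w ⬝ᵥ A *ᵥ x = r * (w ⬝ᵥ x) := by
  rw [dotProduct_mulVec, h.left_eq, smul_dotProduct, smul_eq_mul]

lemma left_dotProduct_pos (h : IsPerron A r v w) (hx : 0 < x) : 0 < w ⬝ᵥ x := by
  obtain ⟨hx0, i, hi⟩ := Pi.lt_def.1 hx
  exact Finset.sum_pos' (fun i _ => mul_nonneg (h.left_pos i).le (hx0 i))
    ⟨i, Finset.mem_univ i, mul_pos (h.left_pos i) hi⟩

lemma le_of_mulVec_le (h : IsPerron A r v w) (hx : 0 < x) (hle : A *ᵥ x ≤ c • x) : r ≤ c := by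
  have hmono : w ⬝ᵥ A *ᵥ x ≤ w ⬝ᵥ c • x :=
    dotProduct_le_dotProduct_of_nonneg_left hle fun i => (h.left_pos i).le
  rw [h.left_dotProduct_mulVec, dotProduct_smul, smul_eq_mul] at hmono
  exact le_of_mul_le_mul_right hmono (h.left_dotProduct_pos hx)

lemma eq_of_mulVec_eq (h : IsPerron A r v w) (hx : 0 < x) (heq : A *ᵥ x = c • x) : r = c := by
  have hdot := h.left_dotProduct_mulVec x
  rw [heq, dotProduct_smul, smul_eq_mul] at hdot
  exact (mul_right_cancel₀ (h.left_dotProduct_pos hx).ne' hdot).symm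

lemma pow [DecidableEq S] (h : IsPerron A r v w) (n : ℕ) : IsPerron (A ^ n) (r ^ n) v w where
  pos := pow_pos h.pos n
  right_pos := h.right_pos
  right_sum := h.right_sum
  left_pos := h.left_pos
  right_eq := pow_mulVec_of_mulVec_eq_smul h.right_eq n
  left_eq := by
    rw [← mulVec_transpose, transpose_pow]
    exact pow_mulVec_of_mulVec_eq_smul ((mulVec_transpose A w).trans h.left_eq) n

end IsPerron

end Perron

section SpectralGap

variable {S 𝕜 : Type*} [Fintype S] [NormedField 𝕜] [NormedAlgebra ℝ 𝕜] {A B : Matrix S S ℝ}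
  {r c : ℝ} {v w x : S → ℝ} {z : 𝕜} {u : S → 𝕜}

lemma norm_map_mulVec_le (hB : ∀ i j, 0 ≤ B i j) (u : S → 𝕜) (i : S) :
    ‖(B.map (algebraMap ℝ 𝕜) *ᵥ u) i‖ ≤ (B *ᵥ fun j => ‖u j‖) i := by
  refine (norm_sum_le _ _).trans_eq (Finset.sum_congr rfl fun j _ => ?_)
  simp [abs_of_nonneg (hB i j)]

lemma exists_pos_mul_le {ι : Type*} [Finite ι] [Nonempty ι] {B : Matrix ι ι ℝ} {v w : ι → ℝ}
    (hB : ∀ i j, 0 < B i j) (hv : ∀ i, 0 < v i) (hw : ∀ i, 0 < w i) :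
    ∃ ε > 0, ∀ i j, ε * (v i * w j) ≤ B i j := by
  have hvw : ∀ p : ι × ι, 0 < v p.1 * w p.2 := fun p => mul_pos (hv p.1) (hw p.2)
  obtain ⟨ε, hε, hle⟩ := exists_gt_forall_mul_le (t := 0) (z := fun p : ι × ι => B p.1 p.2) hvw
    fun p => by simpa only [zero_mul] using hB p.1 p.2
  exact ⟨ε, hε, fun i j => hle (i, j)⟩

namespace IsPerron

lemma left_dotProduct_map_mulVec (h : IsPerron A r v w) (u : S → 𝕜) :
    (algebraMap ℝ 𝕜 ∘ w) ⬝ᵥ A.map (algebraMap ℝ 𝕜) *ᵥ u =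
      algebraMap ℝ 𝕜 r * ((algebraMap ℝ 𝕜 ∘ w) ⬝ᵥ u) := by
  have hleft : (algebraMap ℝ 𝕜 ∘ w) ᵥ* A.map (algebraMap ℝ 𝕜) =
      algebraMap ℝ 𝕜 r • (algebraMap ℝ 𝕜 ∘ w) := by
    ext i
    rw [← RingHom.map_vecMul, h.left_eq]
    simp
  rw [dotProduct_mulVec, hleft, smul_dotProduct, smul_eq_mul]

lemma map_mulVec_right (h : IsPerron A r v w) :
    A.map (algebraMap ℝ 𝕜) *ᵥ (algebraMap ℝ 𝕜 ∘ v) =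
      algebraMap ℝ 𝕜 r • (algebraMap ℝ 𝕜 ∘ v) := by
  ext i
  rw [← RingHom.map_mulVec, h.right_eq]
  simp

lemma map_dotProduct_ne_zero [Nonempty S] (h : IsPerron A r v w) :
    (algebraMap ℝ 𝕜 ∘ w) ⬝ᵥ (algebraMap ℝ 𝕜 ∘ v) ≠ 0 := by
  rw [← RingHom.map_dotProduct]
  simpa using h.dotProduct_pos.ne'

/- On the hyperplane `w ⬝ᵥ u = 0` the positive rank one part `ε v wᵀ` of `B` can be removed, and the
nonnegative remainder has the smaller left Perron eigenvalue `r - ε (w ⬝ᵥ v)`. -/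
lemma norm_lt_of_forall_pos [Nonempty S] (h : IsPerron B r v w) (hB : ∀ i j, 0 < B i j)
    (hu : B.map (algebraMap ℝ 𝕜) *ᵥ u = z • u) (hwu : (algebraMap ℝ 𝕜 ∘ w) ⬝ᵥ u = 0)
    (hu0 : u ≠ 0) : ‖z‖ < r := by
  obtain ⟨ε, hε, hεB⟩ := exists_pos_mul_le hB h.right_pos h.left_pos
  set R : Matrix S S ℝ := B - ε • vecMulVec v w with hR
  have hR0 : ∀ i j, 0 ≤ R i j := fun i j => sub_nonneg.2 (hεB i j)
  have hRu : R.map (algebraMap ℝ 𝕜) *ᵥ u = z • u := by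
    have hmap : R.map (algebraMap ℝ 𝕜) = B.map (algebraMap ℝ 𝕜) -
        algebraMap ℝ 𝕜 ε • vecMulVec (algebraMap ℝ 𝕜 ∘ v) (algebraMap ℝ 𝕜 ∘ w) := by
      ext i j
      simp [hR, vecMulVec_apply, Algebra.smul_def]
    rw [hmap, sub_mulVec, smul_mulVec, vecMulVec_mulVec, hwu, hu]
    simp
  have hle : ∀ i, ‖z‖ * ‖u i‖ ≤ (R *ᵥ fun j => ‖u j‖) i := fun i => by
    simpa only [hRu, Pi.smul_apply, smul_eq_mul, norm_mul] using norm_map_mulVec_le hR0 u i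
  have hleft : w ᵥ* R = (r - ε * (w ⬝ᵥ v)) • w := by
    rw [hR, vecMul_sub, h.left_eq, vecMul_smul, vecMul_vecMulVec, sub_smul, smul_smul]
  have hpos : 0 < w ⬝ᵥ fun j => ‖u j‖ := by
    obtain ⟨i, hi⟩ := Function.ne_iff.1 hu0
    exact h.left_dotProduct_pos (Pi.lt_def.2 ⟨fun j => norm_nonneg (u j), i, norm_pos_iff.2 hi⟩)
  have hz : ‖z‖ ≤ r - ε * (w ⬝ᵥ v) := by
    have hmono : w ⬝ᵥ ‖z‖ • (fun j => ‖u j‖) ≤ w ⬝ᵥ R *ᵥ fun j => ‖u j‖ :=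
      dotProduct_le_dotProduct_of_nonneg_left hle fun i => (h.left_pos i).le
    rw [dotProduct_mulVec, hleft, smul_dotProduct, dotProduct_smul, smul_eq_mul,
      smul_eq_mul] at hmono
    exact le_of_mul_le_mul_right hmono hpos
  linarith [mul_pos hε h.dotProduct_pos]

variable [DecidableEq S]

theorem norm_lt [Nonempty S] (h : IsPerron A r v w) (hA : A.IsPrimitive)
    (hu : A.map (algebraMap ℝ 𝕜) *ᵥ u = z • u) (hwu : (algebraMap ℝ 𝕜 ∘ w) ⬝ᵥ u = 0)
    (hu0 : u ≠ 0) : ‖z‖ < r := by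
  obtain ⟨k, -, hk⟩ := hA.exists_pos_pow
  have hpow : (A ^ k).map (algebraMap ℝ 𝕜) *ᵥ u = z ^ k • u := by
    rw [Matrix.map_pow]
    exact pow_mulVec_of_mulVec_eq_smul hu k
  have hlt := (h.pow k).norm_lt_of_forall_pos hk hpow hwu hu0
  rw [norm_pow] at hlt
  exact lt_of_pow_lt_pow_left₀ k h.pos.le hlt

theorem exists_eq_smul [Nonempty S] (h : IsPerron A r v w) (hA : A.IsPrimitive)
    (hu : A.map (algebraMap ℝ 𝕜) *ᵥ u = algebraMap ℝ 𝕜 r • u) :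
    ∃ a : 𝕜, u = a • (algebraMap ℝ 𝕜 ∘ v) := by
  set a := (algebraMap ℝ 𝕜 ∘ w) ⬝ᵥ u / (algebraMap ℝ 𝕜 ∘ w) ⬝ᵥ (algebraMap ℝ 𝕜 ∘ v) with ha
  refine ⟨a, sub_eq_zero.1 ?_⟩
  by_contra hne
  have hlt : ‖algebraMap ℝ 𝕜 r‖ < r := by
    refine h.norm_lt hA ?_ ?_ hne
    · rw [mulVec_sub, mulVec_smul, hu, h.map_mulVec_right, smul_sub, smul_comm]
    · rw [dotProduct_sub, dotProduct_smul, smul_eq_mul, ha,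
        div_mul_cancel₀ _ h.map_dotProduct_ne_zero, sub_self]
  rw [norm_algebraMap', Real.norm_of_nonneg h.pos.le] at hlt
  exact hlt.false

theorem eq_right_of_mem_stdSimplex [Nonempty S] (h : IsPerron A r v w) (hA : A.IsPrimitive)
    (hx : x ∈ stdSimplex ℝ S) (heq : A *ᵥ x = c • x) : x = v := by
  obtain rfl := h.eq_of_mulVec_eq (pos_of_mem_stdSimplex hx) heq
  obtain ⟨a, rfl⟩ := h.exists_eq_smul hA (𝕜 := ℝ) (u := x) (by simpa using heq)
  obtain rfl : a = 1 := by
    simpa [← Finset.mul_sum, h.right_sum] using hx.2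
  simp

variable {u : S → ℂ}

lemma mem_span_of_pow_sub_smul_apply_eq_zero [Nonempty S] (h : IsPerron A r v w)
    (hA : A.IsPrimitive) (k : ℕ)
    (hu : ((toLin' (A.map (algebraMap ℝ ℂ)) - (r : ℂ) • 1) ^ k) u = 0) :
    u ∈ ℂ ∙ (algebraMap ℝ ℂ ∘ v) := by
  induction k generalizing u with
  | zero =>
    obtain rfl : u = 0 := by simpa using hu
    exact zero_mem _
  | succ k ih =>
    rw [pow_succ, Module.End.mul_apply] at hu
    obtain ⟨a, ha⟩ := Submodule.mem_span_singleton.1 (ih hu)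
    have hau : a • (algebraMap ℝ ℂ ∘ v) =
        A.map (algebraMap ℝ ℂ) *ᵥ u - algebraMap ℝ ℂ r • u := by
      simpa using ha
    have ha0 : a = 0 := by
      have hdot : a * ((algebraMap ℝ ℂ ∘ w) ⬝ᵥ (algebraMap ℝ ℂ ∘ v)) = 0 := by
        rw [← smul_eq_mul, ← dotProduct_smul, hau, dotProduct_sub, h.left_dotProduct_map_mulVec,
          dotProduct_smul, smul_eq_mul, sub_self]
      exact (mul_eq_zero.1 hdot).resolve_right h.map_dotProduct_ne_zero
    rw [ha0, zero_smul, eq_comm, sub_eq_zero] at hau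
    obtain ⟨b, hb⟩ := h.exists_eq_smul hA hau
    exact Submodule.mem_span_singleton.2 ⟨b, hb.symm⟩

lemma maxGenEigenspace_eq_span [Nonempty S] (h : IsPerron A r v w) (hA : A.IsPrimitive) :
    Module.End.maxGenEigenspace (toLin' (A.map (algebraMap ℝ ℂ))) (r : ℂ) =
      ℂ ∙ (algebraMap ℝ ℂ ∘ v) := by
  refine le_antisymm (fun u hu => ?_) ?_
  · obtain ⟨k, hk⟩ := (Module.End.mem_maxGenEigenspace _ _ _).1 hu
    exact h.mem_span_of_pow_sub_smul_apply_eq_zero hA k hk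
  · rw [Submodule.span_singleton_le_iff_mem]
    refine (Module.End.mem_maxGenEigenspace _ _ _).2 ⟨1, ?_⟩
    rw [pow_one, LinearMap.sub_apply, toLin'_apply, h.map_mulVec_right]
    simp

theorem isMaxModulusEigenvalue [Nonempty S] (h : IsPerron A r v w) (hA : A.IsPrimitive) :
    IsMaxModulusEigenvalue A (r : ℂ) := by
  rw [IsMaxModulusEigenvalue, ← charpoly_toLin']
  refine ⟨?_, fun z hz hzr => ?_⟩
  · rw [← LinearMap.finrank_maxGenEigenspace_eq, h.maxGenEigenspace_eq_span hA]
    refine finrank_span_singleton (Function.ne_iff.2 ⟨Classical.arbitrary S, ?_⟩)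
    simpa using (h.right_pos _).ne'
  · obtain ⟨u, hu, hu0⟩ :=
      ((Module.End.hasEigenvalue_iff_isRoot_charpoly _ _).2 hz).exists_hasEigenvector
    rw [Module.End.mem_eigenspace_iff, toLin'_apply] at hu
    have hwu : z * ((algebraMap ℝ ℂ ∘ w) ⬝ᵥ u) = r * ((algebraMap ℝ ℂ ∘ w) ⬝ᵥ u) := by
      rw [← smul_eq_mul, ← dotProduct_smul, ← hu]
      exact h.left_dotProduct_map_mulVec u
    rw [Complex.norm_real, Real.norm_of_nonneg h.pos.le]
    exact h.norm_lt hA hu (by_contra fun hne => hzr (mul_right_cancel₀ hne hwu)) hu0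

end IsPerron

end SpectralGap

section Families

variable {S : Type*} [Fintype S]

lemma tendsto_dotProduct_mulVec {X : Type*} {l : Filter X} {A : X → Matrix S S ℝ}
    {A' : Matrix S S ℝ} {v : X → S → ℝ} {v' : S → ℝ} (hA : Tendsto A l (𝓝 A'))
    (hv : Tendsto v l (𝓝 v')) (w : S → ℝ) :
    Tendsto (fun x => w ⬝ᵥ A x *ᵥ v x) l (𝓝 (w ⬝ᵥ A' *ᵥ v')) := by
  simp only [dotProduct, mulVec]
  exact tendsto_finsetSum _ fun i _ => (tendsto_finsetSum _ fun j _ =>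
    (tendsto_pi_nhds.1 (tendsto_pi_nhds.1 hA i) j).mul (tendsto_pi_nhds.1 hv j)).const_mul _

namespace IsPerron

lemma mulVec_right_eq_sum_smul {A : Matrix S S ℝ} {r : ℝ} {v w : S → ℝ} (h : IsPerron A r v w) :
    A *ᵥ v = (∑ i, (A *ᵥ v) i) • v := by
  simp only [h.right_eq, Pi.smul_apply, smul_eq_mul, ← Finset.mul_sum, h.right_sum, mul_one]

theorem continuousAt_right [DecidableEq S] [Nonempty S] {X : Type*} [TopologicalSpace X]
    {A : X → Matrix S S ℝ} {r : X → ℝ} {v w : X → S → ℝ} {x : X} (hA : ContinuousAt A x)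
    (hprim : (A x).IsPrimitive) (h : ∀ x, IsPerron (A x) (r x) (v x) (w x)) :
    ContinuousAt v x := by
  have hv : ∀ t, v t ∈ stdSimplex ℝ S := fun t => ⟨fun i => ((h t).right_pos i).le, (h t).right_sum⟩
  refine (isCompact_stdSimplex ℝ S).tendsto_nhds_of_unique_mapClusterPt (.of_forall hv)
    fun y hy hcl => ?_
  obtain ⟨U, hU, hvU⟩ := mapClusterPt_iff_ultrafilter.1 hcl
  have hAU : Tendsto A U (𝓝 (A x)) := hA.mono_left hU
  have hmul : Tendsto (fun t => A t *ᵥ v t) U (𝓝 (A x *ᵥ y)) :=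
    ((continuous_fst.matrix_mulVec continuous_snd).tendsto (A x, y)).comp (hAU.prodMk_nhds hvU)
  have hsmul : Tendsto (fun t => A t *ᵥ v t) U (𝓝 ((∑ i, (A x *ᵥ y) i) • y)) := by
    refine Tendsto.congr (fun t => (h t).mulVec_right_eq_sum_smul.symm) ?_
    exact (tendsto_finsetSum _ fun i _ => tendsto_pi_nhds.1 hmul i).smul hvU
  exact (h x).eq_right_of_mem_stdSimplex hprim hy (tendsto_nhds_unique hmul hsmul)

variable {A : ℝ → Matrix S S ℝ} {A' : Matrix S S ℝ} {r : ℝ → ℝ} {v w : ℝ → S → ℝ} {θ : ℝ}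

lemma slope_mul_dotProduct (h : ∀ t, IsPerron (A t) (r t) (v t) (w t)) (θ t : ℝ) :
    slope r θ t * (w θ ⬝ᵥ v t) = w θ ⬝ᵥ slope A θ t *ᵥ v t := by
  have hleft : w θ ⬝ᵥ A θ *ᵥ v t = r θ * (w θ ⬝ᵥ v t) := (h θ).left_dotProduct_mulVec (v t)
  simp only [slope_def_module, smul_mulVec, sub_mulVec, (h t).right_eq, dotProduct_smul,
    dotProduct_sub, hleft, smul_eq_mul]
  ring

theorem hasDerivAt [DecidableEq S] [Nonempty S]
    (hA : ∀ i j, HasDerivAt (fun t => A t i j) (A' i j) θ) (hprim : (A θ).IsPrimitive)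
    (h : ∀ t, IsPerron (A t) (r t) (v t) (w t)) :
    HasDerivAt r (w θ ⬝ᵥ A' *ᵥ v θ / w θ ⬝ᵥ v θ) θ := by
  have hcont : ContinuousAt A θ :=
    tendsto_pi_nhds.2 fun i => tendsto_pi_nhds.2 fun j => (hA i j).continuousAt
  have hv : Tendsto v (𝓝[≠] θ) (𝓝 (v θ)) :=
    (continuousAt_right hcont hprim h).mono_left nhdsWithin_le_nhds
  have hslope : Tendsto (slope A θ) (𝓝[≠] θ) (𝓝 A') :=
    tendsto_pi_nhds.2 fun i => tendsto_pi_nhds.2 fun j => (hA i j).tendsto_slope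
  have hnum : Tendsto (fun t => w θ ⬝ᵥ slope A θ t *ᵥ v t) (𝓝[≠] θ) (𝓝 (w θ ⬝ᵥ A' *ᵥ v θ)) :=
    tendsto_dotProduct_mulVec hslope hv (w θ)
  have hden : Tendsto (fun t => w θ ⬝ᵥ v t) (𝓝[≠] θ) (𝓝 (w θ ⬝ᵥ v θ)) :=
    ((continuous_const.dotProduct continuous_id).tendsto (v θ)).comp hv
  refine hasDerivAt_iff_tendsto_slope.2 ((hnum.div hden (h θ).dotProduct_pos.ne').congr fun t => ?_)
  have hpos : 0 < w θ ⬝ᵥ v t := MarkovTrie.dotProduct_pos (h θ).left_pos (h t).right_pos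
  exact (eq_div_of_mul_eq hpos.ne' (slope_mul_dotProduct h θ t)).symm

end IsPerron

end Families

section PowMatrix

variable {S : Type*} {P : Matrix S S ℝ}

lemma powMatrix_of_pos {i j : S} (h : 0 < P i j) (θ : ℝ) : powMatrix P θ i j = P i j ^ θ := by
  simp [powMatrix, h.ne']

lemma powMatrix_of_eq_zero {i j : S} (h : P i j = 0) (θ : ℝ) : powMatrix P θ i j = 0 := by
  simp [powMatrix, h]

lemma powMatrix_pos {i j : S} (h : 0 < P i j) (θ : ℝ) : 0 < powMatrix P θ i j := by
  rw [powMatrix_of_pos h]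
  exact Real.rpow_pos_of_pos h θ

lemma powMatrix_nonneg (hP : ∀ i j, 0 ≤ P i j) (θ : ℝ) (i j : S) : 0 ≤ powMatrix P θ i j := by
  rcases (hP i j).eq_or_lt with h | h
  · rw [powMatrix_of_eq_zero h.symm]
  · exact (powMatrix_pos h θ).le

lemma powMatrix_one (P : Matrix S S ℝ) : powMatrix P 1 = P := by
  ext i j
  by_cases h : P i j = 0 <;> simp [powMatrix, h]

lemma hasDerivAt_powMatrix (hP : ∀ i j, 0 ≤ P i j) (θ : ℝ) (i j : S) :
    HasDerivAt (fun t => powMatrix P t i j) (powMatrix P θ i j * Real.log (P i j)) θ := by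
  rcases (hP i j).eq_or_lt with h | h
  · simpa [powMatrix_of_eq_zero h.symm] using hasDerivAt_const θ (0 : ℝ)
  · simp only [powMatrix_of_pos h]
    exact (Real.hasStrictDerivAt_const_rpow h θ).hasDerivAt

lemma isPrimitive_powMatrix [Fintype S] [DecidableEq S] (hP : P.IsPrimitive) (θ : ℝ) :
    (powMatrix P θ).IsPrimitive :=
  isPrimitive_of_imp hP (powMatrix_nonneg hP.nonneg θ) fun _ _ h => powMatrix_pos h θ

end PowMatrix

section LogConvexity

variable {ι : Type*} {s t : ℝ}

lemma sum_rpow_mul_rpow_le (u : Finset ι) {f g : ι → ℝ} (hf : ∀ i, 0 ≤ f i) (hg : ∀ i, 0 ≤ g i)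
    (hs : 0 < s) (ht : 0 < t) (hst : s + t = 1) :
    ∑ i ∈ u, f i ^ s * g i ^ t ≤ (∑ i ∈ u, f i) ^ s * (∑ i ∈ u, g i) ^ t := by
  have hpq : s⁻¹.HolderConjugate t⁻¹ :=
    Real.holderConjugate_iff.2 ⟨(one_lt_inv₀ hs).2 (by linarith), by simpa using hst⟩
  have h := Real.inner_le_Lp_mul_Lq_of_nonneg u hpq (fun i _ => Real.rpow_nonneg (hf i) s)
    fun i _ => Real.rpow_nonneg (hg i) t
  simpa only [Real.rpow_rpow_inv (hf _) hs.ne', Real.rpow_rpow_inv (hg _) ht.ne', one_div,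
    inv_inv] using h

variable {S : Type*}

lemma powMatrix_add_mul {P : Matrix S S ℝ} (hP : ∀ i j, 0 ≤ P i j) (hs : s ≠ 0) (a b : ℝ)
    (i j : S) :
    powMatrix P (s * a + t * b) i j = powMatrix P a i j ^ s * powMatrix P b i j ^ t := by
  rcases (hP i j).eq_or_lt with h | h
  · simp [powMatrix_of_eq_zero h.symm, Real.zero_rpow hs]
  · rw [powMatrix_of_pos h, powMatrix_of_pos h, powMatrix_of_pos h, ← Real.rpow_mul h.le,
      ← Real.rpow_mul h.le, ← Real.rpow_add h, mul_comm a, mul_comm b]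

theorem IsPerron.le_rpow_mul_rpow [Fintype S] [Nonempty S] {A B C : Matrix S S ℝ} {a b c : ℝ}
    {vA wA vB wB vC wC : S → ℝ} (hA : IsPerron A a vA wA) (hB : IsPerron B b vB wB)
    (hC : IsPerron C c vC wC) (hA0 : ∀ i j, 0 ≤ A i j) (hB0 : ∀ i j, 0 ≤ B i j) (hs : 0 < s)
    (ht : 0 < t) (hst : s + t = 1) (hle : ∀ i j, C i j ≤ A i j ^ s * B i j ^ t) :
    c ≤ a ^ s * b ^ t := by
  have hA' : ∀ i j, 0 ≤ A i j * vA j := fun i j => mul_nonneg (hA0 i j) (hA.right_pos j).le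
  have hB' : ∀ i j, 0 ≤ B i j * vB j := fun i j => mul_nonneg (hB0 i j) (hB.right_pos j).le
  set x : S → ℝ := fun i => vA i ^ s * vB i ^ t
  have hx : ∀ i, 0 < x i := fun i =>
    mul_pos (Real.rpow_pos_of_pos (hA.right_pos i) s) (Real.rpow_pos_of_pos (hB.right_pos i) t)
  refine hC.le_of_mulVec_le (x := x)
    (Pi.lt_def.2 ⟨fun i => (hx i).le, Classical.arbitrary S, hx _⟩) fun i => ?_
  calc (C *ᵥ x) i ≤ ∑ j, A i j ^ s * B i j ^ t * x j :=
        Finset.sum_le_sum fun j _ => mul_le_mul_of_nonneg_right (hle i j) (hx j).le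
    _ = ∑ j, (A i j * vA j) ^ s * (B i j * vB j) ^ t := by
        refine Finset.sum_congr rfl fun j _ => ?_
        rw [Real.mul_rpow (hA0 i j) (hA.right_pos j).le,
          Real.mul_rpow (hB0 i j) (hB.right_pos j).le, mul_mul_mul_comm]
    _ ≤ (A *ᵥ vA) i ^ s * (B *ᵥ vB) i ^ t :=
        sum_rpow_mul_rpow_le _ (hA' i) (hB' i) hs ht hst
    _ = ((a ^ s * b ^ t) • x) i := by
        rw [hA.right_eq, hB.right_eq, Pi.smul_apply, Pi.smul_apply, Pi.smul_apply, smul_eq_mul,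
          smul_eq_mul, smul_eq_mul, Real.mul_rpow hA.pos.le (hA.right_pos i).le,
          Real.mul_rpow hB.pos.le (hB.right_pos i).le, mul_mul_mul_comm]

end LogConvexity

section PerronRoot

variable {S : Type*} {P : Matrix S S ℝ} {ρ : ℝ → ℝ} {v w : ℝ → S → ℝ} {c : ℝ}

/-- Minus the entrywise derivative of `powMatrix P θ` in `θ`; the sign makes the entries
nonnegative when those of `P` lie in `[0, 1]`. -/
noncomputable def negDerivPowMatrix (P : Matrix S S ℝ) (θ : ℝ) : Matrix S S ℝ :=
  of fun i j => powMatrix P θ i j * -Real.log (P i j)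

lemma negDerivPowMatrix_nonneg (hP : ∀ i j, 0 ≤ P i j) (hP1 : ∀ i j, P i j ≤ 1) (θ : ℝ) (i j : S) :
    0 ≤ negDerivPowMatrix P θ i j :=
  mul_nonneg (powMatrix_nonneg hP θ i j) (neg_nonneg.2 (Real.log_nonpos (hP i j) (hP1 i j)))

variable [Fintype S] [Nonempty S]

theorem convexOn_log_perron (hP : ∀ i j, 0 ≤ P i j)
    (h : ∀ θ, IsPerron (powMatrix P θ) (ρ θ) (v θ) (w θ)) :
    ConvexOn ℝ Set.univ fun θ => Real.log (ρ θ) := by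
  refine convexOn_iff_forall_pos.2 ⟨convex_univ, fun a _ b _ s t hs ht hst => ?_⟩
  have hle : ρ (s * a + t * b) ≤ ρ a ^ s * ρ b ^ t :=
    (h a).le_rpow_mul_rpow (h b) (h _) (powMatrix_nonneg hP a) (powMatrix_nonneg hP b) hs ht hst
      fun i j => (powMatrix_add_mul hP hs.ne' a b i j).le
  have hlog := Real.log_le_log (h _).pos hle
  rwa [Real.log_mul (Real.rpow_pos_of_pos (h a).pos s).ne' (Real.rpow_pos_of_pos (h b).pos t).ne',
    Real.log_rpow (h a).pos, Real.log_rpow (h b).pos] at hlog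

variable [DecidableEq S]

theorem hasDerivAt_perron (hP : P.IsPrimitive)
    (h : ∀ θ, IsPerron (powMatrix P θ) (ρ θ) (v θ) (w θ)) (θ : ℝ) :
    HasDerivAt ρ (-(w θ ⬝ᵥ negDerivPowMatrix P θ *ᵥ v θ / w θ ⬝ᵥ v θ)) θ := by
  have hA : ∀ i j, HasDerivAt (fun t => powMatrix P t i j) ((-negDerivPowMatrix P θ) i j) θ :=
    fun i j => by simpa [negDerivPowMatrix] using hasDerivAt_powMatrix hP.nonneg θ i j
  simpa only [neg_mulVec, dotProduct_neg, neg_div] using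
    IsPerron.hasDerivAt hA (isPrimitive_powMatrix hP θ) h

theorem deriv_perron_neg (hP : P.IsPrimitive) (hP1 : ∀ i j, P i j ≤ 1)
    (hlt : ∃ i j, 0 < P i j ∧ P i j < 1)
    (h : ∀ θ, IsPerron (powMatrix P θ) (ρ θ) (v θ) (w θ)) (θ : ℝ) : deriv ρ θ < 0 := by
  obtain ⟨i, j, hpos, hlt⟩ := hlt
  have hnonneg : ∀ i j, 0 ≤ negDerivPowMatrix P θ i j * v θ j := fun i j =>
    mul_nonneg (negDerivPowMatrix_nonneg hP.nonneg hP1 θ i j) ((h θ).right_pos j).le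
  have hmulVec : 0 < negDerivPowMatrix P θ *ᵥ v θ := by
    refine Pi.lt_def.2 ⟨fun i => Finset.sum_nonneg fun j _ => hnonneg i j, i, ?_⟩
    exact Finset.sum_pos' (fun j _ => hnonneg i j) ⟨j, Finset.mem_univ j, mul_pos
      (mul_pos (powMatrix_pos hpos θ) (neg_pos.2 (Real.log_neg hpos hlt))) ((h θ).right_pos j)⟩
  rw [(hasDerivAt_perron hP h θ).deriv]
  exact neg_neg_of_pos (div_pos ((h θ).left_dotProduct_pos hmulVec) (h θ).dotProduct_pos)

lemma neg_deriv_perron_le (hP : P.IsPrimitive) (hc : ∀ i j, -Real.log (P i j) ≤ c)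
    (h : ∀ θ, IsPerron (powMatrix P θ) (ρ θ) (v θ) (w θ)) (θ : ℝ) : -deriv ρ θ ≤ c * ρ θ := by
  have hle : negDerivPowMatrix P θ *ᵥ v θ ≤ c • (powMatrix P θ *ᵥ v θ) := fun i => by
    simp only [mulVec, dotProduct, Pi.smul_apply, smul_eq_mul, Finset.mul_sum, ← mul_assoc]
    refine Finset.sum_le_sum fun j _ => mul_le_mul_of_nonneg_right ?_ ((h θ).right_pos j).le
    rw [mul_comm c]
    exact mul_le_mul_of_nonneg_left (hc i j) (powMatrix_nonneg hP.nonneg θ i j)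
  rw [(hasDerivAt_perron hP h θ).deriv, neg_neg, div_le_iff₀ (h θ).dotProduct_pos, mul_assoc,
    ← (h θ).left_dotProduct_mulVec, ← smul_eq_mul, ← dotProduct_smul]
  exact dotProduct_le_dotProduct_of_nonneg_left hle fun i => ((h θ).left_pos i).le

lemma one_lt_perron_zero (hP : P.IsPrimitive) (hP1 : P ∈ rowStochastic ℝ S)
    (hlt : ∃ i j, 0 < P i j ∧ P i j < 1)
    (h : ∀ θ, IsPerron (powMatrix P θ) (ρ θ) (v θ) (w θ)) : 1 < ρ 0 := by
  have hone : powMatrix P 1 *ᵥ 1 = (1 : ℝ) • 1 := by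
    rw [powMatrix_one, one_vecMul_of_mem_rowStochastic hP1, one_smul]
  rw [← (h 1).eq_of_mulVec_eq zero_lt_one hone]
  exact strictAnti_of_deriv_neg
    (deriv_perron_neg hP (fun i j => le_one_of_mem_rowStochastic hP1) hlt h) one_pos

theorem exists_pos_tendsto_deriv_log_perron (hP : P.IsPrimitive) (hP1 : ∀ i j, P i j ≤ 1)
    (hlt : ∃ i j, 0 < P i j ∧ P i j < 1)
    (h : ∀ θ, IsPerron (powMatrix P θ) (ρ θ) (v θ) (w θ)) :
    ∃ l > 0, Tendsto (deriv fun θ => Real.log (ρ θ)) atBot (𝓝 (-l)) := by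
  have hdiff : ∀ θ, DifferentiableAt ℝ (fun θ => Real.log (ρ θ)) θ := fun θ =>
    (hasDerivAt_perron hP h θ).differentiableAt.log (h θ).pos.ne'
  have hderiv : ∀ θ, deriv (fun θ => Real.log (ρ θ)) θ = deriv ρ θ / ρ θ := fun θ =>
    deriv.log (hasDerivAt_perron hP h θ).differentiableAt (h θ).pos.ne'
  have hmono : Monotone (deriv fun θ => Real.log (ρ θ)) :=
    monotoneOn_univ.1 ((convexOn_log_perron hP.nonneg h).monotoneOn_deriv fun θ _ => hdiff θ)
  obtain ⟨c, hc⟩ := Finite.bddAbove_range fun p : S × S => -Real.log (P p.1 p.2)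
  have hbdd : BddBelow (Set.range (deriv fun θ => Real.log (ρ θ))) := by
    refine ⟨-c, Set.forall_mem_range.2 fun θ => ?_⟩
    have hle := neg_deriv_perron_le hP (fun i j => hc ⟨(i, j), rfl⟩) h θ
    rw [hderiv, le_div_iff₀ (h θ).pos]
    linarith
  have hneg : deriv (fun θ => Real.log (ρ θ)) 0 < 0 := by
    rw [hderiv]
    exact div_neg_of_neg_of_pos (deriv_perron_neg hP hP1 hlt h 0) (h 0).pos
  refine ⟨-⨅ θ, deriv (fun θ => Real.log (ρ θ)) θ,
    neg_pos.2 ((ciInf_le hbdd 0).trans_lt hneg), ?_⟩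
  rw [neg_neg]
  exact tendsto_atBot_ciInf hmono hbdd

end PerronRoot

section ConvexFunctions

variable {f : ℝ → ℝ} {l Λ : ℝ}

lemma exists_pos_apply_neg_le_of_tendsto_deriv_atBot (hf : ConvexOn ℝ Set.univ f)
    (hd : Differentiable ℝ f) (hl : Tendsto (deriv f) atBot (𝓝 (-l))) (hΛ : l < Λ) :
    ∃ s > 0, f (-s) ≤ s * Λ := by
  have hmono : Monotone (deriv f) := monotoneOn_univ.1 (hf.monotoneOn_deriv fun x _ => hd x)
  have htangent : ∀ s > 0, f (-s) ≤ f 0 + s * l := fun s hs => by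
    have hslope := (hmono.le_of_tendsto hl (-s)).trans
      (hf.deriv_le_slope (Set.mem_univ _) (Set.mem_univ 0) (neg_lt_zero.2 hs) (hd _))
    rw [slope_def_field, le_div_iff₀ (by linarith)] at hslope
    linarith
  have hΛ' : 0 < Λ - l := sub_pos.2 hΛ
  set s := |f 0| / (Λ - l) + 1
  have hs : f 0 ≤ s * (Λ - l) := by
    rw [add_mul, div_mul_cancel₀ _ hΛ'.ne']
    linarith [le_abs_self (f 0)]
  have hs0 : 0 < s := by positivity
  exact ⟨s, hs0, by linarith [htangent s hs0]⟩

lemma exists_lt_sub_of_tendsto_deriv_atBot (hf : ConvexOn ℝ Set.univ f)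
    (hd : Differentiable ℝ f) (hl : Tendsto (deriv f) atBot (𝓝 (-l))) (hΛ : Λ < l) :
    ∃ T, Λ < f (T - 1) - f T := by
  obtain ⟨T, hT⟩ := (hl.eventually_lt_const (neg_lt_neg hΛ)).exists
  have hslope :=
    hf.slope_le_deriv (Set.mem_univ (T - 1)) (Set.mem_univ T) (sub_one_lt T) (hd T)
  rw [slope_def_field, sub_sub_cancel, div_one] at hslope
  exact ⟨T, by linarith⟩

end ConvexFunctions

section PerronRoot

variable {S : Type*} [Fintype S] [DecidableEq S] [Nonempty S] {P : Matrix S S ℝ} {ρ : ℝ → ℝ}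
  {v w : ℝ → S → ℝ} {l : ℝ}

lemma tendsto_perron_div_neg_deriv (hP : P.IsPrimitive)
    (h : ∀ θ, IsPerron (powMatrix P θ) (ρ θ) (v θ) (w θ)) (hl : l ≠ 0)
    (hderiv : Tendsto (deriv fun θ => Real.log (ρ θ)) atBot (𝓝 (-l))) :
    Tendsto (fun θ => ρ θ / -deriv ρ θ) atBot (𝓝 l⁻¹) := by
  rw [← neg_neg l]
  refine (hderiv.neg.inv₀ (by simpa using hl)).congr fun θ => ?_
  rw [deriv.log (hasDerivAt_perron hP h θ).differentiableAt (h θ).pos.ne', ← div_neg, inv_div,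
    neg_div, div_neg]

end PerronRoot

section BoxSize

variable {S : Type*} {P A : Matrix S S ℝ} {i : S} {n : ℕ} {u : Fin n → S} {θ : ℝ}

lemma boxSize_cons (P : Matrix S S ℝ) (i j : S) {n : ℕ} (u : Fin n → S) :
    boxSize P i (Fin.cons j u : Fin (n + 1) → S) = P i j * boxSize P j u := by
  rw [boxSize, Fin.prod_univ_succ]
  rfl

lemma boxSize_nonneg (hP : ∀ i j, 0 ≤ P i j) (i : S) {n : ℕ} (u : Fin n → S) :
    0 ≤ boxSize P i u :=
  Finset.prod_nonneg fun _ _ => hP _ _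

lemma boxSize_snoc (P : Matrix S S ℝ) (i j : S) {n : ℕ} (u : Fin n → S) :
    boxSize P i (Fin.snoc u j : Fin (n + 1) → S) =
      boxSize P i u * P ((Fin.cons i u : Fin (n + 1) → S) (Fin.last n)) j := by
  simp only [boxSize, Fin.cons_snoc_eq_snoc_cons, Fin.prod_univ_castSucc, Fin.snoc_castSucc,
    Fin.snoc_last]

lemma boxSize_powMatrix_of_pos (hP : ∀ i j, 0 ≤ P i j) (hu : 0 < boxSize P i u) (θ : ℝ) :
    boxSize (powMatrix P θ) i u = boxSize P i u ^ θ := by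
  rw [boxSize, boxSize, ← Real.finsetProd_rpow _ _ fun k _ => hP _ _]
  refine Finset.prod_congr rfl fun k hk => powMatrix_of_pos ?_ θ
  exact (hP _ _).lt_of_ne' (Finset.prod_ne_zero_iff.1 hu.ne' k hk)

lemma boxSize_powMatrix_of_eq_zero (hu : boxSize P i u = 0) (θ : ℝ) :
    boxSize (powMatrix P θ) i u = 0 := by
  obtain ⟨k, hk, h0⟩ := Finset.prod_eq_zero_iff.1 hu
  exact Finset.prod_eq_zero hk (powMatrix_of_eq_zero h0 θ)

lemma boxSize_pos_of_boxSize_powMatrix_pos (hP : ∀ i j, 0 ≤ P i j)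
    (hu : 0 < boxSize (powMatrix P θ) i u) : 0 < boxSize P i u :=
  (boxSize_nonneg hP i u).lt_of_ne' fun h0 => hu.ne' (boxSize_powMatrix_of_eq_zero h0 θ)

lemma boxSize_powMatrix_sub_one (hP : ∀ i j, 0 ≤ P i j) (θ : ℝ) (i : S) (u : Fin n → S) :
    boxSize (powMatrix P (θ - 1)) i u =
      boxSize (powMatrix P θ) i u * (boxSize P i u)⁻¹ := by
  rcases (boxSize_nonneg hP i u).eq_or_lt with hu | hu
  · simp [boxSize_powMatrix_of_eq_zero hu.symm]
  · rw [boxSize_powMatrix_of_pos hP hu, boxSize_powMatrix_of_pos hP hu, Real.rpow_sub_one hu.ne',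
      div_eq_mul_inv]

variable [Fintype S]

lemma sum_boxSize [DecidableEq S] (A : Matrix S S ℝ) (n : ℕ) (i : S) :
    ∑ u : Fin n → S, boxSize A i u = (A ^ n *ᵥ 1) i := by
  induction n generalizing i with
  | zero => simp [boxSize]
  | succ n ih =>
    rw [← (Fin.consEquiv fun _ : Fin (n + 1) => S).sum_comp, Fintype.sum_prod_type, pow_succ',
      ← mulVec_mulVec]
    refine Finset.sum_congr rfl fun j _ => ?_
    rw [← ih, Finset.mul_sum]
    exact Finset.sum_congr rfl fun u _ => boxSize_cons A i j u

lemma IsPerron.exists_pos_mul_sum_boxSize_le [Nonempty S] {r : ℝ} {v w : S → ℝ}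
    (h : IsPerron A r v w) (hA : ∀ i j, 0 ≤ A i j) :
    ∃ c > 0, ∀ (n : ℕ) (i : S), c * r ^ n ≤ ∑ u : Fin n → S, boxSize A i u ∧
      c * ∑ u : Fin n → S, boxSize A i u ≤ r ^ n := by
  classical
  obtain ⟨i₁, hi₁⟩ := Finite.exists_min v
  have hv : ∀ i, v i ≤ 1 := fun i =>
    (mem_Icc_of_mem_stdSimplex ⟨fun j => (h.right_pos j).le, h.right_sum⟩ i).2
  refine ⟨v i₁, h.right_pos i₁, fun n i => ?_⟩
  have hAn : ∀ j, 0 ≤ (A ^ n) i j := pow_apply_nonneg hA n i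
  have heq : (A ^ n *ᵥ v) i = r ^ n * v i := congrFun (h.pow n).right_eq i
  rw [sum_boxSize]
  constructor
  · calc v i₁ * r ^ n ≤ (A ^ n *ᵥ v) i := by
          rw [heq, mul_comm]
          exact mul_le_mul_of_nonneg_left (hi₁ i) (pow_nonneg h.pos.le n)
      _ ≤ (A ^ n *ᵥ 1) i := dotProduct_le_dotProduct_of_nonneg_left hv hAn
  · calc v i₁ * (A ^ n *ᵥ 1) i = (A ^ n *ᵥ v i₁ • 1) i := by
          rw [mulVec_smul, Pi.smul_apply, smul_eq_mul]
      _ ≤ (A ^ n *ᵥ v) i :=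
          dotProduct_le_dotProduct_of_nonneg_left (fun j => by simpa using hi₁ j) hAn
      _ ≤ r ^ n := heq.trans_le (mul_le_of_le_one_right (pow_nonneg h.pos.le n) (hv i))

lemma exists_pos_and_le_of_mul_sum_le {ι : Type*} {u : Finset ι} {f g : ι → ℝ} {κ : ℝ}
    (hf : ∀ i ∈ u, 0 ≤ f i) (hpos : 0 < ∑ i ∈ u, f i)
    (hle : κ * ∑ i ∈ u, f i ≤ ∑ i ∈ u, f i * g i) : ∃ i ∈ u, 0 < f i ∧ κ ≤ g i := by
  by_contra! hlt
  obtain ⟨i, hi, hfi⟩ := (Finset.sum_pos_iff_of_nonneg hf).1 hpos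
  refine hle.not_gt ?_
  rw [Finset.mul_sum]
  refine Finset.sum_lt_sum (fun j hj => ?_) ⟨i, hi, ?_⟩
  · rw [mul_comm κ]
    rcases (hf j hj).eq_or_lt with h0 | h0
    · simp [← h0]
    · exact mul_le_mul_of_nonneg_left (hlt j hj h0).le h0.le
  · rw [mul_comm κ]
    exact mul_lt_mul_of_pos_left (hlt i hi hfi) hfi

end BoxSize

section BoxExponent

variable {S : Type*} {P : Matrix S S ℝ} {i : S}

/-- Among the boxes of positive size and generation `n`, seen from the initial state `i`, the
smallest one has size `exp (-n (l + o(1)))`. -/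
structure IsBoxExponent (P : Matrix S S ℝ) (i : S) (l : ℝ) : Prop where
  exists_le_boxSize : ∀ Λ > l, ∃ c > 0, ∀ (n : ℕ) (u : Fin n → S), 0 < boxSize P i u →
    c * Real.exp (-(n * Λ)) ≤ boxSize P i u
  exists_boxSize_le : ∀ Λ < l, ∃ c > 0, ∀ n : ℕ, ∃ u : Fin n → S, 0 < boxSize P i u ∧
    boxSize P i u ≤ c * Real.exp (-(n * Λ))

variable [Fintype S] [Nonempty S] {r : ℝ} {v w : S → ℝ}

theorem IsPerron.exists_le_boxSize {s Λ : ℝ} (hP : ∀ i j, 0 ≤ P i j) (hs : 0 < s)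
    (h : IsPerron (powMatrix P (-s)) r v w) (hr : Real.log r ≤ s * Λ) (i : S) :
    ∃ c > 0, ∀ (n : ℕ) (u : Fin n → S), 0 < boxSize P i u →
      c * Real.exp (-(n * Λ)) ≤ boxSize P i u := by
  have hA := powMatrix_nonneg hP (-s)
  obtain ⟨c, hc, hsum⟩ := h.exists_pos_mul_sum_boxSize_le hA
  refine ⟨c ^ s⁻¹, Real.rpow_pos_of_pos hc _, fun n u hu => ?_⟩
  have hle : c * boxSize P i u ^ (-s) ≤ Real.exp (n * (s * Λ)) := calc
    c * boxSize P i u ^ (-s) ≤ c * ∑ u : Fin n → S, boxSize (powMatrix P (-s)) i u := by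
      rw [← boxSize_powMatrix_of_pos hP hu]
      exact mul_le_mul_of_nonneg_left (Finset.single_le_sum (fun u _ => boxSize_nonneg hA i u)
        (Finset.mem_univ u)) hc.le
    _ ≤ r ^ n := (hsum n i).2
    _ ≤ Real.exp (s * Λ) ^ n :=
      pow_le_pow_left₀ h.pos.le ((Real.log_le_iff_le_exp h.pos).1 hr) n
    _ = Real.exp (n * (s * Λ)) := (Real.exp_nat_mul _ n).symm
  rw [← Real.rpow_le_rpow_iff (by positivity) hu.le hs,
    Real.mul_rpow (by positivity) (by positivity), Real.rpow_inv_rpow hc.le hs.ne', ← Real.exp_mul]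
  rw [Real.rpow_neg hu.le, ← div_eq_mul_inv, div_le_iff₀ (by positivity)] at hle
  rwa [neg_mul, Real.exp_neg, ← div_eq_mul_inv, div_le_iff₀ (by positivity), mul_comm (_ ^ s),
    mul_assoc, mul_comm Λ]

theorem IsPerron.exists_boxSize_le {T r' Λ : ℝ} {v' w' : S → ℝ} (hP : ∀ i j, 0 ≤ P i j)
    (h : IsPerron (powMatrix P T) r v w) (h' : IsPerron (powMatrix P (T - 1)) r' v' w')
    (hr : Λ ≤ Real.log r' - Real.log r) (i : S) :
    ∃ c > 0, ∀ n : ℕ, ∃ u : Fin n → S, 0 < boxSize P i u ∧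
      boxSize P i u ≤ c * Real.exp (-(n * Λ)) := by
  obtain ⟨c, hc, hsum⟩ := h.exists_pos_mul_sum_boxSize_le (powMatrix_nonneg hP T)
  obtain ⟨c', hc', hsum'⟩ := h'.exists_pos_mul_sum_boxSize_le (powMatrix_nonneg hP (T - 1))
  refine ⟨(c * c')⁻¹, by positivity, fun n => ?_⟩
  have hrr : Real.exp (n * Λ) * r ^ n ≤ r' ^ n := by
    rw [← Real.log_div h'.pos.ne' h.pos.ne', Real.le_log_iff_exp_le (div_pos h'.pos h.pos),
      le_div_iff₀ h.pos] at hr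
    rw [Real.exp_nat_mul, ← mul_pow]
    exact pow_le_pow_left₀ (mul_pos (Real.exp_pos _) h.pos).le hr n
  have hle : c * c' * Real.exp (n * Λ) * ∑ u : Fin n → S, boxSize (powMatrix P T) i u ≤
      ∑ u : Fin n → S, boxSize (powMatrix P T) i u * (boxSize P i u)⁻¹ := calc
    _ = c' * Real.exp (n * Λ) * (c * ∑ u : Fin n → S, boxSize (powMatrix P T) i u) := by ring
    _ ≤ c' * Real.exp (n * Λ) * r ^ n := mul_le_mul_of_nonneg_left (hsum n i).2 (by positivity)
    _ ≤ c' * r' ^ n := by rw [mul_assoc]; exact mul_le_mul_of_nonneg_left hrr hc'.le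
    _ ≤ ∑ u : Fin n → S, boxSize (powMatrix P (T - 1)) i u := (hsum' n i).1
    _ = _ := Finset.sum_congr rfl fun u _ => boxSize_powMatrix_sub_one hP T i u
  obtain ⟨u, -, hu, hκ⟩ := exists_pos_and_le_of_mul_sum_le
    (fun u _ => boxSize_nonneg (powMatrix_nonneg hP T) i u)
    ((mul_pos hc (pow_pos h.pos n)).trans_le (hsum n i).1) hle
  have hu' := boxSize_pos_of_boxSize_powMatrix_pos hP hu
  refine ⟨u, hu', ?_⟩
  rw [Real.exp_neg, ← mul_inv]
  exact (le_inv_comm₀ (by positivity) hu').1 hκ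

theorem isBoxExponent_of_tendsto_deriv_log_perron [DecidableEq S] (hP : P.IsPrimitive)
    {ρ : ℝ → ℝ} {v w : ℝ → S → ℝ} {l : ℝ} (h : ∀ θ, IsPerron (powMatrix P θ) (ρ θ) (v θ) (w θ))
    (hderiv : Tendsto (deriv fun θ => Real.log (ρ θ)) atBot (𝓝 (-l))) (i : S) :
    IsBoxExponent P i l := by
  have hconv := convexOn_log_perron hP.nonneg h
  have hdiff : Differentiable ℝ fun θ => Real.log (ρ θ) := fun θ =>
    (hasDerivAt_perron hP h θ).differentiableAt.log (h θ).pos.ne'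
  refine ⟨fun Λ hΛ => ?_, fun Λ hΛ => ?_⟩
  · obtain ⟨s, hs, hle⟩ :=
      exists_pos_apply_neg_le_of_tendsto_deriv_atBot hconv hdiff hderiv hΛ
    exact (h (-s)).exists_le_boxSize hP.nonneg hs hle i
  · obtain ⟨T, hT⟩ := exists_lt_sub_of_tendsto_deriv_atBot hconv hdiff hderiv hΛ
    exact (h T).exists_boxSize_le hP.nonneg (h (T - 1)) hT.le i

lemma exists_lt_card_boxSize_pos (hP : ∀ i j, 0 ≤ P i j) (h : IsPerron (powMatrix P 0) r v w)
    (hr : 1 < r) (i : S) (m : ℕ) :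
    ∃ n : ℕ, m < Nat.card {u : Fin n → S // 0 < boxSize P i u} := by
  classical
  obtain ⟨c, hc, hsum⟩ := h.exists_pos_mul_sum_boxSize_le (powMatrix_nonneg hP 0)
  obtain ⟨n, hn⟩ := ((tendsto_pow_atTop_atTop_of_one_lt hr).const_mul_atTop hc
    |>.eventually_gt_atTop (m : ℝ)).exists
  refine ⟨n, ?_⟩
  have hcard : ∑ u : Fin n → S, boxSize (powMatrix P 0) i u =
      Nat.card {u : Fin n → S // 0 < boxSize P i u} := by
    rw [Nat.card_eq_fintype_card, Fintype.card_subtype, Finset.card_filter, Nat.cast_sum]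
    refine Finset.sum_congr rfl fun u _ => ?_
    split_ifs with hu
    · simp [boxSize_powMatrix_of_pos hP hu]
    · simp [boxSize_powMatrix_of_eq_zero (le_antisymm (not_lt.1 hu) (boxSize_nonneg hP i u))]
  exact_mod_cast hn.trans_le ((hsum n i).1.trans_eq hcard)

end BoxExponent

/-- The trajectories that pass through the box indexed by `u`. The state at time `0` is left free,
as in `ballCount`. -/
def boxPaths {S : Type*} {n : ℕ} (u : Fin n → S) : Set (ℕ → S) :=
  {x | ∀ k : Fin n, x (k + 1) = u k}

section Saturation

variable {S Ω : Type*} {P : Matrix S S ℝ} {i₀ : S} {Y : ℕ → ℕ → Ω → S} {m m' j n n' : ℕ} {ω : Ω}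
  {u : Fin n → S} {u' : Fin n' → S}

lemma ballCount_pos_iff : 0 < ballCount Y m u ω ↔ ∃ b < m, (Y b · ω) ∈ boxPaths u := by
  simp only [ballCount, Finset.card_pos, Finset.filter_nonempty_iff, Finset.mem_range]
  rfl

lemma ballCount_mono (hm : m ≤ m') (hu : boxPaths u ⊆ boxPaths u') :
    ballCount Y m u ω ≤ ballCount Y m' u' ω := by
  refine Finset.card_le_card fun b hb => ?_
  simp only [Finset.mem_filter, Finset.mem_range] at hb ⊢
  exact ⟨hb.1.trans_le hm, @hu (Y b · ω) hb.2⟩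

lemma le_ballCount_of_forall_exists_mem_Ico (h : ∀ i < j,
    ∃ b ∈ Finset.Ico (i * (m / j)) ((i + 1) * (m / j)), (Y b · ω) ∈ boxPaths u) :
    j ≤ ballCount Y m u ω := by
  rw [← Finset.card_range j]
  refine Finset.card_le_card_of_surjOn (· / (m / j)) fun i hi => ?_
  have hij : i < j := by simpa using hi
  obtain ⟨b, hb, hbu⟩ := h i hij
  obtain ⟨hle, hlt⟩ := Finset.mem_Ico.1 hb
  have hbm : b < m := hlt.trans_le ((Nat.mul_le_mul_right _ hij).trans (Nat.mul_div_le m j))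
  refine ⟨b, ?_, Nat.div_eq_of_lt_le hle hlt⟩
  simp only [Finset.coe_filter, Finset.mem_range]
  exact ⟨hbm, hbu⟩

lemma hasDeficientBox_of_lt_card (hm : m < Nat.card {u : Fin n → S // 0 < boxSize P i₀ u})
    (hj : 1 ≤ j) : HasDeficientBox P i₀ Y m j n ω := by
  by_contra hdef
  simp only [HasDeficientBox, not_exists, not_and, not_lt] at hdef
  have hball : ∀ u : {u : Fin n → S // 0 < boxSize P i₀ u},
      ∃ b : Fin m, (Y b · ω) ∈ boxPaths u.1 := fun u => by
    obtain ⟨b, hbm, hb⟩ := ballCount_pos_iff.1 (hj.trans (hdef u.1 u.2))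
    exact ⟨⟨b, hbm⟩, hb⟩
  choose b hb using hball
  have hinj : Function.Injective b := fun u u' huu => Subtype.ext <| funext fun k => by
    rw [← hb u k, ← hb u' k, huu]
  exact hm.not_ge (by simpa using Nat.card_le_card_of_injective b hinj)

lemma HasDeficientBox.anti_balls (h : HasDeficientBox P i₀ Y m' j n ω) (hm : m ≤ m') :
    HasDeficientBox P i₀ Y m j n ω := by
  obtain ⟨u, hu, hc⟩ := h
  exact ⟨u, hu, (ballCount_mono hm subset_rfl).trans_lt hc⟩

lemma HasDeficientBox.mono_generation [Fintype S] [DecidableEq S] (hP : P ∈ rowStochastic ℝ S)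
    (h : HasDeficientBox P i₀ Y m j n ω) (hn : n ≤ n') : HasDeficientBox P i₀ Y m j n' ω := by
  induction n', hn using Nat.le_induction with
  | base => exact h
  | succ n' _ ih =>
    obtain ⟨u, hu, hc⟩ := ih
    set i := (Fin.cons i₀ u : Fin (n' + 1) → S) (Fin.last n')
    obtain ⟨k, -, hk⟩ : ∃ k ∈ Finset.univ, 0 < P i k :=
      Finset.exists_lt_of_sum_lt (by simp [sum_row_of_mem_rowStochastic hP])
    refine ⟨Fin.snoc u k, ?_, (ballCount_mono le_rfl fun x hx l => ?_).trans_lt hc⟩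
    · rw [boxSize_snoc]
      exact mul_pos hu hk
    · simpa using hx l.castSucc

lemma saturationLevel_le (h : HasDeficientBox P i₀ Y m j n ω) :
    saturationLevel P i₀ Y m j ω ≤ n := Nat.sInf_le h

lemma lt_saturationLevel [Fintype S] [DecidableEq S] (hP : P ∈ rowStochastic ℝ S)
    (hex : ∃ n, HasDeficientBox P i₀ Y m j n ω) (h : ¬ HasDeficientBox P i₀ Y m j n ω) :
    n < saturationLevel P i₀ Y m j ω := by
  by_contra! hle
  have hmem : HasDeficientBox P i₀ Y m j (saturationLevel P i₀ Y m j ω) ω := Nat.sInf_mem hex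
  exact h (hmem.mono_generation hP hle)

end Saturation

section BoxPaths

variable {S Ω : Type*} [MeasurableSpace S] [MeasurableSingletonClass S] [MeasurableSpace Ω]
  {P : Matrix S S ℝ} {i₀ : S} {μ : Measure Ω}

lemma measurableSet_boxPaths {n : ℕ} (u : Fin n → S) : MeasurableSet (boxPaths u) := by
  rw [boxPaths, Set.ofPred_forall]
  exact MeasurableSet.iInter fun k =>
    measurable_pi_apply (X := fun _ => S) ((k : ℕ) + 1) (measurableSet_singleton (u k))

variable [DecidableEq S] {X : ℕ → Ω → S}

lemma IsMarkovChain.measurableSet_mem_boxPaths (h : IsMarkovChain X P i₀ μ) {n : ℕ}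
    (u : Fin n → S) : MeasurableSet {ω | (X · ω) ∈ boxPaths u} :=
  measurable_pi_iff.2 h.measurable (measurableSet_boxPaths u)

variable [IsProbabilityMeasure μ]

lemma IsMarkovChain.ae_zero_eq (h : IsMarkovChain X P i₀ μ) : ∀ᵐ ω ∂μ, X 0 ω = i₀ := by
  have hlaw := h.law (fun _ => i₀) 0
  simp only [Nat.le_zero, forall_eq, if_true, Finset.range_zero, Finset.prod_empty,
    ENNReal.ofReal_one] at hlaw
  exact (mem_ae_iff_prob_eq_one (h.measurable 0 (measurableSet_singleton i₀))).2 hlaw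

lemma IsMarkovChain.measure_mem_boxPaths (h : IsMarkovChain X P i₀ μ) {n : ℕ} (u : Fin n → S) :
    μ {ω | (X · ω) ∈ boxPaths u} = ENNReal.ofReal (boxSize P i₀ u) := by
  obtain ⟨w, hw⟩ : ∃ w : ℕ → S, ∀ k : Fin (n + 1), w k = (Fin.cons i₀ u : Fin (n + 1) → S) k :=
    ⟨Function.extend Fin.val (Fin.cons i₀ u : Fin (n + 1) → S) fun _ => i₀,
      Fin.val_injective.extend_apply _ _⟩
  have hw_zero : w 0 = i₀ := hw 0
  have hw_succ : ∀ k : Fin n, w (k + 1) = u k := fun k => hw k.succ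
  have hw_castSucc : ∀ k : Fin n, w k = (Fin.cons i₀ u : Fin (n + 1) → S) k.castSucc :=
    fun k => hw k.castSucc
  have hlaw := h.law w n
  rw [if_pos hw_zero, Finset.prod_range] at hlaw
  simp only [hw_succ, hw_castSucc] at hlaw
  rw [boxSize, ← hlaw]
  refine measure_congr (eventuallyEq_set.2 ?_)
  filter_upwards [h.ae_zero_eq] with ω hω
  refine ⟨fun hu k hk => ?_, fun hk k => (hk (k + 1) k.2).trans (hw_succ k)⟩
  rcases k with _ | k
  · rw [hω, hw_zero]
  · exact (hu ⟨k, hk⟩).trans (hw_succ ⟨k, hk⟩).symm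

end BoxPaths

section BallCount

variable {S Ω : Type*} [DecidableEq S] [MeasurableSpace S] [MeasurableSingletonClass S]
  [MeasurableSpace Ω] {P : Matrix S S ℝ} {i₀ : S} {μ : Measure Ω} [IsProbabilityMeasure μ]
  {Y : ℕ → ℕ → Ω → S}

lemma measure_ballCount_pos_le (hY : ∀ b, IsMarkovChain (Y b) P i₀ μ) {n : ℕ} (u : Fin n → S)
    (m : ℕ) : μ {ω | 0 < ballCount Y m u ω} ≤ ENNReal.ofReal (m * boxSize P i₀ u) := by
  have hsub : {ω | 0 < ballCount Y m u ω} ⊆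
      ⋃ b ∈ Finset.range m, {ω | (Y b · ω) ∈ boxPaths u} := fun ω hω => by
    obtain ⟨b, hbm, hbu⟩ := ballCount_pos_iff.1 hω
    exact Set.mem_biUnion (Finset.mem_range.2 hbm) hbu
  refine (measure_mono hsub).trans ((measure_biUnion_finset_le _ _).trans_eq ?_)
  simp only [(hY _).measure_mem_boxPaths, Finset.sum_const, Finset.card_range, nsmul_eq_mul]
  rw [ENNReal.ofReal_mul m.cast_nonneg, ENNReal.ofReal_natCast]

lemma measure_forall_notMem_boxPaths_le (hP : ∀ i j, 0 ≤ P i j)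
    (hY : ∀ b, IsMarkovChain (Y b) P i₀ μ)
    (hindep : iIndepFun (fun (b : ℕ) (ω : Ω) (n : ℕ) => Y b n ω) μ) {n : ℕ} (u : Fin n → S)
    (T : Finset ℕ) : μ (⋂ b ∈ T, {ω | (Y b · ω) ∉ boxPaths u}) ≤
      ENNReal.ofReal (Real.exp (-(boxSize P i₀ u * T.card))) := by
  have hmiss : ∀ b, μ {ω | (Y b · ω) ∉ boxPaths u} ≤
      ENNReal.ofReal (Real.exp (-boxSize P i₀ u)) := fun b => by
    have hcompl := prob_compl_eq_one_sub (μ := μ) ((hY b).measurableSet_mem_boxPaths u)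
    rw [(hY b).measure_mem_boxPaths, ← ENNReal.ofReal_one,
      ← ENNReal.ofReal_sub _ (boxSize_nonneg hP i₀ u)] at hcompl
    exact hcompl.trans_le (ENNReal.ofReal_le_ofReal (Real.one_sub_le_exp_neg _))
  calc μ (⋂ b ∈ T, {ω | (Y b · ω) ∉ boxPaths u})
      = ∏ b ∈ T, μ {ω | (Y b · ω) ∉ boxPaths u} :=
        hindep.measure_inter_preimage_eq_mul T (sets := fun _ => (boxPaths u)ᶜ)
          fun _ _ => (measurableSet_boxPaths u).compl
    _ ≤ ∏ _b ∈ T, ENNReal.ofReal (Real.exp (-boxSize P i₀ u)) :=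
        Finset.prod_le_prod' fun b _ => hmiss b
    _ = ENNReal.ofReal (Real.exp (-(boxSize P i₀ u * T.card))) := by
        rw [Finset.prod_const, ← ENNReal.ofReal_pow (Real.exp_pos _).le, ← Real.exp_nat_mul,
          mul_neg, mul_comm]

/- The first `m` balls contain `j` disjoint blocks of `m / j` balls; a box with fewer than `j` balls
is missed by an entire block. -/
lemma measure_ballCount_lt_le (hP : ∀ i j, 0 ≤ P i j) (hY : ∀ b, IsMarkovChain (Y b) P i₀ μ)
    (hindep : iIndepFun (fun (b : ℕ) (ω : Ω) (n : ℕ) => Y b n ω) μ) {n : ℕ} (u : Fin n → S)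
    (m j : ℕ) : μ {ω | ballCount Y m u ω < j} ≤
      ENNReal.ofReal (j * Real.exp (-(boxSize P i₀ u * (m / j : ℕ)))) := by
  set block : ℕ → Finset ℕ := fun i => Finset.Ico (i * (m / j)) ((i + 1) * (m / j))
  have hblock : ∀ i, (block i).card = m / j := fun i => by
    rw [Nat.card_Ico, add_mul, one_mul, Nat.add_sub_cancel_left]
  have hsub : {ω | ballCount Y m u ω < j} ⊆
      ⋃ i ∈ Finset.range j, ⋂ b ∈ block i, {ω | (Y b · ω) ∉ boxPaths u} := fun ω hω => by
    by_contra hne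
    have hmeet : ∀ i < j, ∃ b ∈ block i, (Y b · ω) ∈ boxPaths u := by simpa using hne
    exact (le_ballCount_of_forall_exists_mem_Ico hmeet).not_gt hω
  refine (measure_mono hsub).trans ((measure_biUnion_finset_le _ _).trans ?_)
  calc ∑ i ∈ Finset.range j, μ (⋂ b ∈ block i, {ω | (Y b · ω) ∉ boxPaths u})
      ≤ ∑ _i ∈ Finset.range j, ENNReal.ofReal (Real.exp (-(boxSize P i₀ u * (m / j : ℕ)))) :=
        Finset.sum_le_sum fun i _ =>
          hblock i ▸ measure_forall_notMem_boxPaths_le hP hY hindep u (block i)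
    _ = _ := by
        rw [Finset.sum_const, Finset.card_range, nsmul_eq_mul, ENNReal.ofReal_mul j.cast_nonneg,
          ENNReal.ofReal_natCast]

lemma measure_hasDeficientBox_le [Fintype S] (hP : ∀ i j, 0 ≤ P i j)
    (hY : ∀ b, IsMarkovChain (Y b) P i₀ μ)
    (hindep : iIndepFun (fun (b : ℕ) (ω : Ω) (n : ℕ) => Y b n ω) μ) {n : ℕ} {q : ℝ}
    (hq : ∀ u : Fin n → S, 0 < boxSize P i₀ u → q ≤ boxSize P i₀ u) (m j : ℕ) :
    μ {ω | HasDeficientBox P i₀ Y m j n ω} ≤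
      ENNReal.ofReal ((Fintype.card S : ℝ) ^ n * (j * Real.exp (-(q * (m / j : ℕ))))) := by
  have hbox : ∀ u : Fin n → S, μ {ω | 0 < boxSize P i₀ u ∧ ballCount Y m u ω < j} ≤
      ENNReal.ofReal (j * Real.exp (-(q * (m / j : ℕ)))) := fun u => by
    by_cases hu : 0 < boxSize P i₀ u
    · simp only [hu, true_and]
      refine (measure_ballCount_lt_le hP hY hindep u m j).trans (ENNReal.ofReal_le_ofReal ?_)
      gcongr
      exact hq u hu
    · simp [hu]
  calc μ {ω | HasDeficientBox P i₀ Y m j n ω}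
      = μ (⋃ u : Fin n → S, {ω | 0 < boxSize P i₀ u ∧ ballCount Y m u ω < j}) := by
        simp only [HasDeficientBox, Set.ofPred_exists]
    _ ≤ ∑ u : Fin n → S, μ {ω | 0 < boxSize P i₀ u ∧ ballCount Y m u ω < j} :=
        measure_iUnion_fintype_le _ _
    _ ≤ ∑ _u : Fin n → S, ENNReal.ofReal (j * Real.exp (-(q * (m / j : ℕ)))) :=
        Finset.sum_le_sum fun u _ => hbox u
    _ = _ := by
        rw [Finset.sum_const, Finset.card_univ, Fintype.card_fun, Fintype.card_fin, nsmul_eq_mul,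
          ← ENNReal.ofReal_natCast, ← ENNReal.ofReal_mul (Nat.cast_nonneg _), Nat.cast_pow]

end BallCount

section Summability

lemma summable_pow_mul_exp_neg_exp {K a δ : ℝ} (hK : 0 ≤ K) (ha : 0 < a) (hδ : 0 < δ) :
    Summable fun n : ℕ => K ^ n * Real.exp (-(a * Real.exp (n * δ))) := by
  obtain ⟨k, hk⟩ := pow_unbounded_of_one_lt (2 * K) (Real.one_lt_exp_iff.2 hδ)
  have hE : 0 < Real.exp δ ^ k := by positivity
  have hratio : K / Real.exp δ ^ k ≤ 1 / 2 := by
    rw [div_le_div_iff₀ hE two_pos]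
    linarith
  refine Summable.of_nonneg_of_le (fun n => by positivity) (fun n => ?_)
    (summable_geometric_two.mul_left (k.factorial / a ^ k))
  have hpow : (a * Real.exp (n * δ)) ^ k = a ^ k * (Real.exp δ ^ k) ^ n := by
    rw [mul_pow, Real.exp_nat_mul, pow_right_comm]
  have hexp : Real.exp (-(a * Real.exp (n * δ))) ≤
      k.factorial / (a ^ k * (Real.exp δ ^ k) ^ n) := by
    rw [Real.exp_neg, ← inv_div, ← hpow]
    exact inv_anti₀ (by positivity) (Real.pow_div_factorial_le_exp _ (by positivity) k)
  calc K ^ n * Real.exp (-(a * Real.exp (n * δ)))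
      ≤ K ^ n * (k.factorial / (a ^ k * (Real.exp δ ^ k) ^ n)) := by gcongr
    _ = k.factorial / a ^ k * (K / Real.exp δ ^ k) ^ n := by
        rw [div_pow]
        field_simp
    _ ≤ k.factorial / a ^ k * (1 / 2) ^ n := by gcongr

lemma exp_neg_mul_ceil_exp_div_le {c x y : ℝ} (hc : 0 ≤ c) (hx : 0 ≤ x) (j : ℕ) :
    Real.exp (-(c * Real.exp (-x) * (⌈Real.exp (x + y)⌉₊ / j : ℕ))) ≤
      Real.exp c * Real.exp (-(c / j * Real.exp y)) := by
  have hfloor : Real.exp (x + y) / j - 1 ≤ (⌈Real.exp (x + y)⌉₊ / j : ℕ) := calc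
    Real.exp (x + y) / j - 1 ≤ (⌈Real.exp (x + y)⌉₊ : ℝ) / j - 1 := by
      gcongr
      exact Nat.le_ceil _
    _ ≤ (⌈Real.exp (x + y)⌉₊ / j : ℕ) := by
      rw [← Nat.floor_div_eq_div (K := ℝ)]
      exact (Nat.sub_one_lt_floor _).le
  rw [← Real.exp_add, Real.exp_le_exp, neg_le, neg_add, neg_neg, ← sub_eq_neg_add]
  calc c / j * Real.exp y - c
      ≤ c / j * Real.exp y - c * Real.exp (-x) :=
        sub_le_sub_left (mul_le_of_le_one_right hc (Real.exp_le_one_iff.2 (neg_nonpos.2 hx))) _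
    _ = c * Real.exp (-x) * (Real.exp (x + y) / j - 1) := by
        rw [← neg_add_cancel_left x y, Real.exp_add (-x), neg_add_cancel_left]
        ring
    _ ≤ c * Real.exp (-x) * (⌈Real.exp (x + y)⌉₊ / j : ℕ) := by gcongr

lemma ae_eventually_notMem_of_summable {Ω : Type*} [MeasurableSpace Ω] {μ : Measure Ω}
    {s : ℕ → Set Ω} {g : ℕ → ℝ} (hg : Summable g) (h : ∀ n, μ (s n) ≤ ENNReal.ofReal (g n)) :
    ∀ᵐ ω ∂μ, ∀ᶠ n in atTop, ω ∉ s n :=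
  ae_eventually_notMem (ne_top_of_le_ne_top hg.tsum_ofReal_ne_top (ENNReal.tsum_le_tsum h))

end Summability

section AlmostSure

variable {S Ω : Type*} [DecidableEq S] [MeasurableSpace S] [MeasurableSingletonClass S]
  {P : Matrix S S ℝ} {i₀ : S} [MeasurableSpace Ω] {μ : Measure Ω} [IsProbabilityMeasure μ]
  {Y : ℕ → ℕ → Ω → S} {l κ : ℝ} {j : ℕ}

theorem IsBoxExponent.ae_eventually_not_hasDeficientBox [Finite S] (hl : IsBoxExponent P i₀ l)
    (hP : ∀ i j, 0 ≤ P i j) (hY : ∀ b, IsMarkovChain (Y b) P i₀ μ)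
    (hindep : iIndepFun (fun (b : ℕ) (ω : Ω) (n : ℕ) => Y b n ω) μ) (hl0 : 0 ≤ l) (hκ : l < κ)
    (hj : 1 ≤ j) :
    ∀ᵐ ω ∂μ, ∀ᶠ n : ℕ in atTop, ¬ HasDeficientBox P i₀ Y ⌈Real.exp (n * κ)⌉₊ j n ω := by
  cases nonempty_fintype S
  obtain ⟨Λ, hlΛ, hΛκ⟩ := exists_between hκ
  obtain ⟨c, hc, hsize⟩ := hl.exists_le_boxSize Λ hlΛ
  have hj0 : (0 : ℝ) < j := by exact_mod_cast hj
  have hsum := (summable_pow_mul_exp_neg_exp (K := Fintype.card S) (Nat.cast_nonneg _)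
    (div_pos hc hj0) (sub_pos.2 hΛκ)).mul_left (j * Real.exp c)
  refine ae_eventually_notMem_of_summable hsum fun n =>
    (measure_hasDeficientBox_le hP hY hindep (hsize n) _ j).trans (ENNReal.ofReal_le_ofReal ?_)
  have hexp := exp_neg_mul_ceil_exp_div_le (x := n * Λ) (y := n * (κ - Λ)) hc.le
    (mul_nonneg n.cast_nonneg (hl0.trans hlΛ.le)) j
  rw [← mul_add, add_sub_cancel] at hexp
  calc _ ≤ (Fintype.card S : ℝ) ^ n *
        (j * (Real.exp c * Real.exp (-(c / j * Real.exp (n * (κ - Λ)))))) := by gcongr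
    _ = _ := by ring

theorem IsBoxExponent.ae_eventually_hasDeficientBox (hl : IsBoxExponent P i₀ l)
    (hY : ∀ b, IsMarkovChain (Y b) P i₀ μ) (hκ0 : 0 ≤ κ) (hκ : κ < l) (hj : 1 ≤ j) :
    ∀ᵐ ω ∂μ, ∀ᶠ n : ℕ in atTop, HasDeficientBox P i₀ Y ⌈Real.exp (n * κ)⌉₊ j n ω := by
  obtain ⟨Λ, hκΛ, hΛl⟩ := exists_between hκ
  obtain ⟨c, -, hsize⟩ := hl.exists_boxSize_le Λ hΛl
  choose u hu0 hu using hsize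
  have hsum : Summable fun n : ℕ => 2 * c * Real.exp (n * (κ - Λ)) :=
    (Real.summable_exp_nat_mul_iff.2 (sub_neg.2 hκΛ)).mul_left _
  have hempty : ∀ᵐ ω ∂μ, ∀ᶠ n : ℕ in atTop, ¬ 0 < ballCount Y ⌈Real.exp (n * κ)⌉₊ (u n) ω := by
    refine ae_eventually_notMem_of_summable hsum fun n =>
      (measure_ballCount_pos_le hY (u n) _).trans (ENNReal.ofReal_le_ofReal ?_)
    have hceil : (⌈Real.exp (n * κ)⌉₊ : ℝ) ≤ 2 * Real.exp (n * κ) := Nat.ceil_le_two_mul <|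
      (by norm_num : (2⁻¹ : ℝ) ≤ 1).trans (Real.one_le_exp (mul_nonneg n.cast_nonneg hκ0))
    calc (⌈Real.exp (n * κ)⌉₊ : ℝ) * boxSize P i₀ (u n)
        ≤ 2 * Real.exp (n * κ) * (c * Real.exp (-(n * Λ))) :=
          mul_le_mul hceil (hu n) (hu0 n).le (by positivity)
      _ = 2 * c * Real.exp (n * (κ - Λ)) := by
          rw [mul_sub, sub_eq_add_neg, Real.exp_add]
          ring
  filter_upwards [hempty] with ω hω
  filter_upwards [hω] with n hn
  exact ⟨u n, hu0 n, (not_lt.1 hn).trans_lt hj⟩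

end AlmostSure

section Asymptotics

variable {S Ω : Type*} {P : Matrix S S ℝ} {i₀ : S} {Y : ℕ → ℕ → Ω → S} {j : ℕ} {ω : Ω} {κ : ℝ}

lemma tendsto_log_natCast_atTop : Tendsto (fun m : ℕ => Real.log m) atTop atTop :=
  Real.tendsto_log_atTop.comp tendsto_natCast_atTop_atTop

lemma eventually_saturationLevel_le (hκ : 0 < κ)
    (h : ∀ᶠ n : ℕ in atTop, HasDeficientBox P i₀ Y ⌈Real.exp (n * κ)⌉₊ j n ω) :
    ∀ᶠ m : ℕ in atTop, (saturationLevel P i₀ Y m j ω : ℝ) ≤ Real.log m / κ + 1 := by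
  have hn : Tendsto (fun m : ℕ => ⌈Real.log m / κ⌉₊) atTop atTop :=
    tendsto_nat_ceil_atTop.comp (tendsto_log_natCast_atTop.atTop_div_const hκ)
  filter_upwards [hn.eventually h, eventually_gt_atTop 0] with m hm hm0
  have hle : m ≤ ⌈Real.exp (⌈Real.log m / κ⌉₊ * κ)⌉₊ := by
    have hlog : Real.log m ≤ ⌈Real.log m / κ⌉₊ * κ := (div_le_iff₀ hκ).1 (Nat.le_ceil _)
    rw [Real.log_le_iff_le_exp (by exact_mod_cast hm0)] at hlog
    exact_mod_cast hlog.trans (Nat.le_ceil _)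
  calc (saturationLevel P i₀ Y m j ω : ℝ) ≤ ⌈Real.log m / κ⌉₊ := by
        exact_mod_cast saturationLevel_le (hm.anti_balls hle)
    _ ≤ Real.log m / κ + 1 :=
        (Nat.ceil_lt_add_one (div_nonneg (Real.log_natCast_nonneg m) hκ.le)).le

lemma eventually_le_saturationLevel [Fintype S] [DecidableEq S] (hP : P ∈ rowStochastic ℝ S)
    (hκ : 0 < κ) (hex : ∀ m, ∃ n, HasDeficientBox P i₀ Y m j n ω)
    (h : ∀ᶠ n : ℕ in atTop, ¬ HasDeficientBox P i₀ Y ⌈Real.exp (n * κ)⌉₊ j n ω) :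
    ∀ᶠ m : ℕ in atTop, Real.log m / κ - 1 ≤ saturationLevel P i₀ Y m j ω := by
  have hn : Tendsto (fun m : ℕ => ⌊Real.log m / κ⌋₊) atTop atTop :=
    tendsto_nat_floor_atTop.comp (tendsto_log_natCast_atTop.atTop_div_const hκ)
  filter_upwards [hn.eventually h, eventually_gt_atTop 0] with m hm hm0
  have hle : ⌈Real.exp (⌊Real.log m / κ⌋₊ * κ)⌉₊ ≤ m := by
    rw [Nat.ceil_le, ← Real.le_log_iff_exp_le (by exact_mod_cast hm0), ← le_div_iff₀ hκ]
    exact Nat.floor_le (div_nonneg (Real.log_natCast_nonneg m) hκ.le)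
  calc Real.log m / κ - 1 ≤ ⌊Real.log m / κ⌋₊ := (Nat.sub_one_lt_floor _).le
    _ ≤ saturationLevel P i₀ Y m j ω := by
        exact_mod_cast (lt_saturationLevel hP (hex m) fun hd => hm (hd.anti_balls hle)).le

lemma tendsto_div_of_eventually_bounds {α : Type*} {f : Filter α} {G L : α → ℝ} {κ₁ κ₂ : ℕ → ℝ}
    {l : ℝ} (hL : Tendsto L f atTop) (hl : l ≠ 0) (hκ₁ : Tendsto κ₁ atTop (𝓝 l))
    (hκ₂ : Tendsto κ₂ atTop (𝓝 l)) (hlow : ∀ k, ∀ᶠ m in f, L m / κ₁ k - 1 ≤ G m)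
    (hup : ∀ k, ∀ᶠ m in f, G m ≤ L m / κ₂ k + 1) :
    Tendsto (fun m => G m / L m) f (𝓝 l⁻¹) := by
  have hbound : ∀ κ b : ℝ, Tendsto (fun m => (L m / κ + b) / L m) f (𝓝 κ⁻¹) := fun κ b => by
    have hlim : Tendsto (fun m => κ⁻¹ + b * (L m)⁻¹) f (𝓝 κ⁻¹) := by
      simpa using (hL.inv_tendsto_atTop.const_mul b).const_add κ⁻¹
    refine hlim.congr' ?_
    filter_upwards [hL.eventually_gt_atTop 0] with m hm
    field_simp
  refine tendsto_order.2 ⟨fun a ha => ?_, fun a ha => ?_⟩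
  · obtain ⟨k, hk⟩ := ((hκ₁.inv₀ hl).eventually (lt_mem_nhds ha)).exists
    filter_upwards [hlow k, hL.eventually_gt_atTop 0,
      (hbound (κ₁ k) (-1)).eventually (lt_mem_nhds hk)] with m hm hm0 ham
    exact ham.trans_le (div_le_div_of_nonneg_right hm hm0.le)
  · obtain ⟨k, hk⟩ := ((hκ₂.inv₀ hl).eventually (gt_mem_nhds ha)).exists
    filter_upwards [hup k, hL.eventually_gt_atTop 0,
      (hbound (κ₂ k) 1).eventually (gt_mem_nhds hk)] with m hm hm0 ham
    exact (div_le_div_of_nonneg_right hm hm0.le).trans_lt ham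

theorem IsBoxExponent.ae_tendsto_saturationLevel_div_log [Fintype S] [DecidableEq S]
    [MeasurableSpace S] [MeasurableSingletonClass S] [MeasurableSpace Ω] {μ : Measure Ω}
    [IsProbabilityMeasure μ] {l : ℝ} (hl : IsBoxExponent P i₀ l) (hl0 : 0 < l)
    (hP : P ∈ rowStochastic ℝ S) (hY : ∀ b, IsMarkovChain (Y b) P i₀ μ)
    (hindep : iIndepFun (fun (b : ℕ) (ω : Ω) (n : ℕ) => Y b n ω) μ) (hj : 1 ≤ j)
    (hex : ∀ m ω, ∃ n, HasDeficientBox P i₀ Y m j n ω) :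
    ∀ᵐ ω ∂μ, Tendsto (fun m : ℕ => (saturationLevel P i₀ Y m j ω : ℝ) / Real.log m) atTop
      (𝓝 l⁻¹) := by
  obtain ⟨κ₁, -, hκ₁, hκ₁l⟩ := exists_seq_strictAnti_tendsto l
  obtain ⟨κ₂, -, hκ₂, hκ₂l⟩ := exists_seq_strictMono_tendsto' hl0
  have hlow := ae_all_iff.2 fun k => hl.ae_eventually_not_hasDeficientBox
    (fun _ _ => nonneg_of_mem_rowStochastic hP) hY hindep hl0.le (hκ₁ k) hj
  have hup := ae_all_iff.2 fun k =>
    hl.ae_eventually_hasDeficientBox hY (hκ₂ k).1.le (hκ₂ k).2 hj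
  filter_upwards [hlow, hup] with ω hωlow hωup
  exact tendsto_div_of_eventually_bounds tendsto_log_natCast_atTop hl0.ne' hκ₁l hκ₂l
    (fun k => eventually_le_saturationLevel hP (hl0.trans (hκ₁ k)) (hex · ω) (hωlow k))
    fun k => eventually_saturationLevel_le (hκ₂ k).1 (hωup k)

end Asymptotics

end MarkovTrie

theorem theorem3 {S : Type*} [Fintype S] [DecidableEq S] [Nontrivial S]
    [MeasurableSpace S] [MeasurableSingletonClass S]
    (P : Matrix S S ℝ) (hP : P ∈ Matrix.rowStochastic ℝ S)
    (hirr : P.IsIrreducible) (haper : MarkovTrie.IsAperiodic P) (i₀ : S)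
    {Ω : Type*} [MeasurableSpace Ω] (μ : Measure Ω) [IsProbabilityMeasure μ]
    (Y : ℕ → ℕ → Ω → S)
    (hY : ∀ b, MarkovTrie.IsMarkovChain (Y b) P i₀ μ)
    (hindep : iIndepFun (fun (b : ℕ) (ω : Ω) (n : ℕ) => Y b n ω) μ) :
    ∃ (ρ : ℝ → ℝ) (C : ℝ),
      (∀ θ : ℝ, MarkovTrie.IsMaxModulusEigenvalue (MarkovTrie.powMatrix P θ) (ρ θ : ℂ)) ∧
      Differentiable ℝ ρ ∧
      0 < C ∧
      Tendsto (fun θ : ℝ => ρ θ / (-deriv ρ θ)) atBot (𝓝 C) ∧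
      ∀ j : ℕ, 1 ≤ j →
        (∀ (m : ℕ) (ω : Ω), ∃ n : ℕ, MarkovTrie.HasDeficientBox P i₀ Y m j n ω) ∧
        ∀ᵐ ω ∂μ, Tendsto
          (fun m : ℕ => (MarkovTrie.saturationLevel P i₀ Y m j ω : ℝ) / Real.log (m : ℝ))
          atTop (𝓝 C) := by
  have hprim := haper.isPrimitive hirr
  have hlt := MarkovTrie.exists_pos_lt_one_of_isPrimitive hP hprim
  choose ρ v w hperron using fun θ =>
    MarkovTrie.exists_isPerron (MarkovTrie.isPrimitive_powMatrix hprim θ)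
  obtain ⟨l, hl, hderiv⟩ := MarkovTrie.exists_pos_tendsto_deriv_log_perron hprim
    (fun _ _ => Matrix.le_one_of_mem_rowStochastic hP) hlt hperron
  have hbox : MarkovTrie.IsBoxExponent P i₀ l :=
    MarkovTrie.isBoxExponent_of_tendsto_deriv_log_perron hprim hperron hderiv i₀
  have hdeficient : ∀ j, 1 ≤ j → ∀ (m : ℕ) (ω : Ω), ∃ n,
      MarkovTrie.HasDeficientBox P i₀ Y m j n ω := fun j hj m ω =>
    (MarkovTrie.exists_lt_card_boxSize_pos hprim.nonneg (hperron 0)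
      (MarkovTrie.one_lt_perron_zero hprim hP hlt hperron) i₀ m).imp fun n hn =>
        MarkovTrie.hasDeficientBox_of_lt_card hn hj
  exact ⟨ρ, l⁻¹,
    fun θ => (hperron θ).isMaxModulusEigenvalue (MarkovTrie.isPrimitive_powMatrix hprim θ),
    fun θ => (MarkovTrie.hasDerivAt_perron hprim hperron θ).differentiableAt,
    inv_pos.2 hl,
    MarkovTrie.tendsto_perron_div_neg_deriv hprim hperron hl.ne' hderiv,
    fun j hj => ⟨hdeficient j hj,
      hbox.ae_tendsto_saturationLevel_div_log hl hP hY hindep hj (hdeficient j hj)⟩⟩
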